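/- **Notation.** $\mathbb R_+=(0,\infty)$; all functionals are antilinear (conjugate-linear) and $\langle\cdot,\cdot\rangle$ is linear in the first argument. * $C_0^\infty(\mathbb R_+)'$ is the space of continuous antilinear functionals on $C_0^\infty(\mathbb R_+)$ (complex-valued functions). $(\mathsf Lf)(\lambda)=\int_0^\infty e^{-t\lambda}f(t)\,dt$ is the Laplace transform and $(\bar f\star f)(t)=\int_0^t\overline{f(s)}f(t-s)\,ds$. * $\mathcal Y$ is the space of entire functions $\varphi$ with $|\varphi(\lambda)|\le C_n(1+|\lambda|)^{-n}e^{r_\pm|\operatorname{Re}\lambda|}$ for $\pm\operatorname{Re}\lambda\ge0$ and all $n$, for some $r_+=r_+(\varphi)<0$ and some $r_-=r_-(\varphi)\in\mathbb R$; $\varphi_k\to0$ in $\mathcal Y$ means that these bounds hold with common constants $r_\pm$ ($r_+<0$), $C_n$, and $\varphi_k\to0$ uniformly on compact subsets of $\mathbb C$. $\mathcal Y'$ is the space of antilinear functionals on $\mathcal Y$ that are continuous for this convergence. $\mathsf L$ maps $C_0^\infty(\mathbb R_+)$ into $\mathcal Y$. * $\mathcal S_0$ is the space of $g\in C^\infty(\mathbb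 R_+)$ with $|g^{(k)}(\lambda)|\le C_{\varkappa,k}\lambda^{-1/2-k}(1+|\ln\lambda|)^{-\varkappa}$ for all $k=0,1,2,\dots$ and all $\varkappa\in\mathbb R$, with the Fréchet topology given by the best constants; $\mathcal S_0'$ is the space of continuous antilinear functionals on it. Restrictions to $\mathbb R_+$ of functions in $\mathcal Y$ lie in $\mathcal S_0$, and $C_0^\infty(\mathbb R_+)\subset\mathcal S_0$. * $\sigma\in\mathcal Y'$ is the sigma-function of $h\in C_0^\infty(\mathbb R_+)'$ if $h=\mathsf L^*\sigma$, i.e. $\langle h,F\rangle=\langle\sigma,\mathsf LF\rangle$ for all $F\in C_0^\infty(\mathbb R_+)$. The condition "$\operatorname{supp}\sigma\subset[0,\infty)$ and $\sigma\in\mathcal S_0'$" means that there is a functional in $\mathcal S_0'$, again denoted $\sigma$, such that $\langle\sigma,w\rangle=\langle\sigma,w|_{\mathbb R_+}\rangle$ for all $w\in\mathcal Y$. * $h[f,f]=\langle h,\bar f\star f\rangle$ and $\sigma[w,w]=\langle\sigma,\bar w w\rangle$ for $f,w\in C_0^\infty(\mathbb R_+)$. $N_\pm(h;C_0^\infty(\mathbb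 R_+))\in\{0,1,2,\dots,\infty\}$ is the maximal dimension of complex linear sets $M\subset C_0^\infty(\mathbb R_+)$ such that $\pm\operatorname{Re}h[f,f]>0$ for all $f\in M$, $f\ne0$; $N_\pm(\sigma;C_0^\infty(\mathbb R_+))$ is defined in the same way. (If $h$ is real, i.e. $\overline{\langle h,F\rangle}=\langle h,\overline F\rangle$ for all $F$, then both forms are real and $\operatorname{Re}$ can be omitted.) **Theorem.** Let $h\in C_0^\infty(\mathbb R_+)'$ and let $\sigma\in\mathcal Y'$ be its sigma-function. Suppose that $\operatorname{supp}\sigma\subset[0,\infty)$ and $\sigma\in\mathcal S_0'$. Then $$N_\pm(h;C_0^\infty(\mathbb R_+))=N_\pm(\sigma;C_0^\infty(\mathbb R_+))$$ for both signs. Moreover, for either choice of the sign: 1. If $\pm\sigma\ge0$, i.e. $\pm\langle\sigma,\varphi\rangle\ge0$ for all $\varphi\in C_0^\infty(\mathbb R_+)$ with $\varphi\ge0$, then $\pm\langle h,\bar f\star f\rangle\ge0$ for all $f\in C_0^\infty(\mathbb R_+)$. 2. Let $\Delta=(a,b)$ with $0\le a<b<\infty$. If $\sigma$ coincides on $\Delta$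 with a real function of class $L^1_{\rm loc}(\Delta)$ and $\pm\sigma(\lambda)\ge\sigma_0$ for almost all $\lambda\in\Delta$ with some constant $\sigma_0>0$, then $N_\pm(h;C_0^\infty(\mathbb R_+))=\infty$. -/

import Mathlib

open MeasureTheory Set Filter Topology
open scoped Distributions ContDiff ComplexOrder Convolution Pointwise

noncomputable section

namespace HankelSigma

/-! ### Test functions on the half-line and their dual -/

/-- The open half-line `ℝ₊ = (0, ∞)`. -/
def Rpos : TopologicalSpace.Opens ℝ := ⟨Ioi 0, isOpen_Ioi⟩

/-- `C₀^∞(ℝ₊)`: smooth complex functions with compact support contained in `(0, ∞)`,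
with its canonical LF topology. -/
abbrev Test : Type := 𝓓(Rpos, ℂ)

/-- `C₀^∞(ℝ₊)'`: continuous antilinear functionals on `C₀^∞(ℝ₊)`. -/
abbrev TestDual : Type := Test →SL[starRingEnd ℂ] ℂ

lemma Test.eq_zero (f : Test) {x : ℝ} (hx : x ≤ 0) : f x = 0 := by
  by_contra h
  have : x ∈ Ioi (0 : ℝ) := f.tsupport_subset (subset_tsupport _ h)
  exact absurd this (not_lt.mpr hx)

/-- The derivative of a test function. -/
def Test.deriv (f : Test) : Test where
  toFun := _root_.deriv f
  contDiff' := by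
    have h : ContDiff ℝ ∞ f := f.contDiff
    exact (contDiff_infty_iff_deriv.1 h).2
  hasCompactSupport' := f.hasCompactSupport.deriv
  tsupport_subset' := tsupport_deriv_subset.trans f.tsupport_subset

/-- The function `t ↦ conj (f t)`. -/
def Test.conj (f : Test) : Test where
  toFun t := (starRingEnd ℂ) (f t)
  contDiff' := Complex.conjCLE.contDiff.comp f.contDiff
  hasCompactSupport' := f.hasCompactSupport.comp_left (g := starRingEnd ℂ) (map_zero _)
  tsupport_subset' :=
    (closure_mono (Function.support_comp_subset (map_zero (starRingEnd ℂ)) f)).trans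
      f.tsupport_subset

/-- The pointwise product of two test functions. -/
def Test.mul (f g : Test) : Test where
  toFun t := f t * g t
  contDiff' := f.contDiff.mul g.contDiff
  hasCompactSupport' := f.hasCompactSupport.mul_right
  tsupport_subset' := (tsupport_mul_subset_left (f := f) (g := g)).trans f.tsupport_subset

lemma Test.laplaceConv_aux (f g : Test) :
    (fun t : ℝ => ∫ s in (0 : ℝ)..t, f s * g (t - s)) =
      ((f : ℝ → ℂ) ⋆[ContinuousLinearMap.mul ℝ ℂ, volume] (g : ℝ → ℂ)) := by
  funext t
  simp only [convolution, ContinuousLinearMap.mul_apply']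
  rcases le_total 0 t with ht | ht
  · rw [intervalIntegral.integral_of_le ht]
    refine setIntegral_eq_integral_of_forall_compl_eq_zero fun s hs => ?_
    rcases le_or_gt s 0 with h | h
    · rw [f.eq_zero h, zero_mul]
    · have : t < s := by
        by_contra h'
        exact hs ⟨h, not_lt.1 h'⟩
      rw [g.eq_zero (by linarith), mul_zero]
  · rw [intervalIntegral.integral_of_ge ht, setIntegral_eq_zero_of_forall_eq_zero, neg_zero,
      integral_eq_zero_of_ae]
    · refine Eventually.of_forall fun s => ?_
      rcases le_or_gt s 0 with h | h
      · simp [f.eq_zero h]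
      · simp [g.eq_zero (x := t - s) (by linarith)]
    · intro s hs
      rw [f.eq_zero hs.2, zero_mul]

/-- The Laplace convolution `(f ⋆ g)(t) = ∫₀ᵗ f(s) g(t - s) ds` of test functions. -/
def Test.laplaceConv (f g : Test) : Test where
  toFun t := ∫ s in (0 : ℝ)..t, f s * g (t - s)
  contDiff' := by
    rw [f.laplaceConv_aux g]
    exact g.hasCompactSupport.contDiff_convolution_right _
      f.continuous.locallyIntegrable g.contDiff
  hasCompactSupport' := by
    rw [f.laplaceConv_aux g]
    exact HasCompactSupport.convolution _ f.hasCompactSupport g.hasCompactSupport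
  tsupport_subset' := by
    rw [f.laplaceConv_aux g]
    have h : tsupport ((f : ℝ → ℂ) ⋆[ContinuousLinearMap.mul ℝ ℂ, volume] (g : ℝ → ℂ)) ⊆
        tsupport f + tsupport g :=
      closure_minimal
        ((support_convolution_subset _).trans (add_subset_add subset_closure subset_closure))
        (f.hasCompactSupport.isCompact.add g.hasCompactSupport.isCompact).isClosed
    intro x hx
    obtain ⟨a, ha, b, hb, rfl⟩ := h hx
    have ha' : (0 : ℝ) < a := f.tsupport_subset ha
    have hb' : (0 : ℝ) < b := g.tsupport_subset hb
    exact add_pos ha' hb'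

/-! ### The space `𝒴` of Laplace transforms and its dual -/

/-- The bounds `|φ(λ)| ≤ Cₙ (1 + |λ|)⁻ⁿ e^{r± |Re λ|}` for `± Re λ ≥ 0` and all `n`. -/
def YBound (rp rm : ℝ) (C : ℕ → ℝ) (φ : ℂ → ℂ) : Prop :=
  ∀ (n : ℕ) (z : ℂ),
    (0 ≤ z.re → ‖φ z‖ ≤ C n * ((1 + ‖z‖) ^ n)⁻¹ * Real.exp (rp * |z.re|)) ∧
    (z.re ≤ 0 → ‖φ z‖ ≤ C n * ((1 + ‖z‖) ^ n)⁻¹ * Real.exp (rm * |z.re|))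

lemma YBound.mono {rp rm rp' rm' : ℝ} {C : ℕ → ℝ} {φ : ℂ → ℂ} (h : YBound rp rm C φ)
    (hp : rp ≤ rp') (hm : rm ≤ rm') : YBound rp' rm' C φ := by
  intro n z
  have hC : 0 ≤ C n := by
    have := (norm_nonneg _).trans ((h n 0).1 (by simp))
    simpa using this
  have h0 : 0 ≤ C n * ((1 + ‖z‖) ^ n)⁻¹ := by positivity
  refine ⟨fun hz => ((h n z).1 hz).trans ?_, fun hz => ((h n z).2 hz).trans ?_⟩ <;> gcongr

/-- The space `𝒴`: entire functions obeying the bounds `YBound` with some `r₊ < 0` and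
some `r₋`. -/
def Y : Submodule ℂ (ℂ → ℂ) where
  carrier := {φ | Differentiable ℂ φ ∧ ∃ rp rm : ℝ, ∃ C : ℕ → ℝ, rp < 0 ∧ YBound rp rm C φ}
  zero_mem' := ⟨differentiable_const _, -1, 0, 0, by norm_num, fun n z => by simp⟩
  add_mem' := by
    rintro φ ψ ⟨hφ, rp, rm, C, hr, hb⟩ ⟨hψ, rp', rm', C', hr', hb'⟩
    refine ⟨hφ.add hψ, max rp rp', max rm rm', C + C', max_lt hr hr', fun n z => ?_⟩
    have h1 := (hb.mono (le_max_left rp rp') (le_max_left rm rm')) n z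
    have h2 := (hb'.mono (le_max_right rp rp') (le_max_right rm rm')) n z
    refine ⟨fun hz => (norm_add_le _ _).trans ((add_le_add (h1.1 hz) (h2.1 hz)).trans_eq ?_),
      fun hz => (norm_add_le _ _).trans ((add_le_add (h1.2 hz) (h2.2 hz)).trans_eq ?_)⟩ <;>
    · simp only [Pi.add_apply]; ring
  smul_mem' := by
    rintro c φ ⟨hφ, rp, rm, C, hr, hb⟩
    refine ⟨hφ.const_smul c, rp, rm, fun n => ‖c‖ * C n, hr, fun n z => ?_⟩
    simp only [Pi.smul_apply, norm_smul, mul_assoc]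
    refine ⟨fun hz => ?_, fun hz => ?_⟩
    · have := (hb n z).1 hz
      rw [mul_assoc] at this
      gcongr
    · have := (hb n z).2 hz
      rw [mul_assoc] at this
      gcongr

/-- Convergence `φₖ → 0` in `𝒴`: common constants in the bounds, and uniform convergence on
all compact subsets of `ℂ`. -/
def YTendstoZero (φ : ℕ → Y) : Prop :=
  (∃ rp rm : ℝ, ∃ C : ℕ → ℝ, rp < 0 ∧ ∀ k, YBound rp rm C (φ k : ℂ → ℂ)) ∧
  ∀ K : Set ℂ, IsCompact K → TendstoUniformlyOn (fun k => (φ k : ℂ → ℂ)) 0 atTop K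

/-- `𝒴'`: antilinear functionals on `𝒴`, continuous for the above convergence. -/
structure YDual where
  /-- the underlying antilinear functional -/
  toFun : Y →ₛₗ[starRingEnd ℂ] ℂ
  tendsto_zero' : ∀ φ : ℕ → Y, YTendstoZero φ → Tendsto (fun k => toFun (φ k)) atTop (𝓝 0)

instance : CoeFun YDual (fun _ => Y → ℂ) := ⟨fun σ => σ.toFun⟩

/-! ### The Laplace transform `C₀^∞(ℝ₊) → 𝒴` -/

/-- `(L f)(λ) = ∫₀^∞ e^{-tλ} f(t) dt`. -/
def laplace (f : ℝ → ℂ) (z : ℂ) : ℂ := ∫ t in Ioi (0 : ℝ), Complex.exp (-((t : ℂ) * z)) * f t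

lemma laplace_eq (f : Test) (z : ℂ) :
    laplace f z = ∫ t : ℝ, Complex.exp (-((t : ℂ) * z)) * f t := by
  refine setIntegral_eq_integral_of_forall_compl_eq_zero fun t ht => ?_
  rw [f.eq_zero (not_lt.1 ht), mul_zero]

lemma laplace_integrand_integrable (f : Test) (z : ℂ) :
    Integrable fun t : ℝ => Complex.exp (-((t : ℂ) * z)) * f t := by
  refine Continuous.integrable_of_hasCompactSupport (by fun_prop) ?_
  exact f.hasCompactSupport.mul_left

lemma laplace_deriv (f : Test) (z : ℂ) : laplace f.deriv z = z * laplace f z := by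
  rw [laplace_eq, laplace_eq]
  have hd : ∀ t : ℝ, HasDerivAt (fun t : ℝ => Complex.exp (-((t : ℂ) * z)))
      (-z * Complex.exp (-((t : ℂ) * z))) t := by
    intro t
    have h1 : HasDerivAt (fun w : ℂ => Complex.exp (-(w * z)))
        (-z * Complex.exp (-((t : ℂ) * z))) (t : ℂ) := by
      have := (((hasDerivAt_id (t : ℂ)).mul_const z).neg).cexp
      simpa [mul_comm] using! this
    exact h1.comp_ofReal
  have hf : ∀ t : ℝ, HasDerivAt f (f.deriv t) t := fun t =>
    ((f.contDiff.differentiable (by simp)) t).hasDerivAt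
  have := integral_mul_deriv_eq_deriv_mul_of_integrable
    (u := fun t : ℝ => Complex.exp (-((t : ℂ) * z))) (v := f)
    (fun t _ => hd t) (fun t _ => hf t) (laplace_integrand_integrable f.deriv z)
    (by
      have := (laplace_integrand_integrable f z).const_mul (-z)
      refine this.congr (Eventually.of_forall fun t => ?_)
      simp [mul_assoc])
    (laplace_integrand_integrable f z)
  rw [this, ← integral_neg, ← integral_const_mul]
  congr 1
  funext t
  ring

lemma laplace_iter (f : Test) (n : ℕ) (z : ℂ) :
    laplace (Test.deriv^[n] f) z = z ^ n * laplace f z := by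
  induction n with
  | zero => simp
  | succ n ih => rw [Function.iterate_succ_apply', laplace_deriv, ih]; ring

lemma laplace_differentiable (f : Test) : Differentiable ℂ (laplace f) := by
  intro z₀
  obtain ⟨R, hR⟩ := f.hasCompactSupport.isCompact.isBounded.subset_closedBall (0 : ℝ)
  have hzero : ∀ t : ℝ, R < |t| → f t = 0 := by
    intro t ht
    by_contra h
    have := hR (subset_tsupport _ h)
    rw [mem_closedBall_zero_iff, Real.norm_eq_abs] at this
    linarith
  have hfun : laplace f = fun z => ∫ t : ℝ, Complex.exp (-((t : ℂ) * z)) * f t :=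
    funext (laplace_eq f)
  rw [hfun]
  have hint : Integrable fun t : ℝ => R * Real.exp (R * (‖z₀‖ + 1)) * ‖f t‖ :=
    ((f.continuous.integrable_of_hasCompactSupport f.hasCompactSupport).norm).const_mul _
  refine (hasDerivAt_integral_of_dominated_loc_of_deriv_le
    (F' := fun z (t : ℝ) => -(t : ℂ) * Complex.exp (-((t : ℂ) * z)) * f t)
    (bound := fun t => R * Real.exp (R * (‖z₀‖ + 1)) * ‖f t‖)
    (Metric.ball_mem_nhds z₀ one_pos) ?_ (laplace_integrand_integrable f z₀) ?_ ?_ hint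
    ?_).2.differentiableAt
  · exact Eventually.of_forall fun z => (laplace_integrand_integrable f z).aestronglyMeasurable
  · exact (by fun_prop : Continuous fun t : ℝ =>
      -(t : ℂ) * Complex.exp (-((t : ℂ) * z₀)) * f t).aestronglyMeasurable
  · refine Eventually.of_forall fun t z hz => ?_
    rcases lt_or_ge R |t| with h | h
    · simp [hzero t h]
    · have hz' : ‖z‖ ≤ ‖z₀‖ + 1 := by
        have h1 : ‖z - z₀‖ < 1 := by simpa [dist_eq_norm] using hz
        have h2 := norm_add_le z₀ (z - z₀)
        rw [add_sub_cancel] at h2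
        linarith
      have hR0 : 0 ≤ R := (abs_nonneg t).trans h
      rw [norm_mul, norm_mul, norm_neg, Complex.norm_real, Real.norm_eq_abs, Complex.norm_exp]
      have h3 : (-((t : ℂ) * z)).re ≤ R * (‖z₀‖ + 1) := by
        refine (Complex.re_le_norm _).trans ?_
        rw [norm_neg, norm_mul, Complex.norm_real, Real.norm_eq_abs]
        gcongr
      gcongr
  · refine Eventually.of_forall fun t z _ => ?_
    have := ((((hasDerivAt_id z).const_mul (t : ℂ)).neg).cexp).mul_const (f t)
    simpa [mul_comm] using! this

lemma laplace_norm_le (f : Test) {a b : ℝ} (hab : ∀ t, f t ≠ 0 → a ≤ t ∧ t ≤ b) (z : ℂ) :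
    (0 ≤ z.re → ‖laplace f z‖ ≤ (∫ t : ℝ, ‖f t‖) * Real.exp (-a * |z.re|)) ∧
    (z.re ≤ 0 → ‖laplace f z‖ ≤ (∫ t : ℝ, ‖f t‖) * Real.exp (b * |z.re|)) := by
  have hint : Integrable fun t : ℝ => ‖f t‖ :=
    (f.continuous.integrable_of_hasCompactSupport f.hasCompactSupport).norm
  have key : ∀ c : ℝ, (∀ t, f t ≠ 0 → -(t * z.re) ≤ c) →
      ‖laplace f z‖ ≤ (∫ t : ℝ, ‖f t‖) * Real.exp c := by
    intro c hc
    rw [laplace_eq, ← integral_mul_const]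
    refine norm_integral_le_of_norm_le (hint.mul_const _) (Eventually.of_forall fun t => ?_)
    rcases eq_or_ne (f t) 0 with h | h
    · simp [h]
    · rw [norm_mul, Complex.norm_exp, mul_comm]
      have := hc t h
      gcongr
      simpa using this
  refine ⟨fun hz => key _ fun t ht => ?_, fun hz => key _ fun t ht => ?_⟩
  · rw [abs_of_nonneg hz]
    nlinarith [(hab t ht).1]
  · rw [abs_of_nonpos hz]
    nlinarith [(hab t ht).2]

lemma Test.iterate_deriv_tsupport (f : Test) (n : ℕ) :
    tsupport (Test.deriv^[n] f) ⊆ tsupport f := by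
  induction n with
  | zero => exact subset_rfl
  | succ n ih =>
    rw [Function.iterate_succ_apply']
    exact tsupport_deriv_subset.trans ih

lemma laplace_mem (f : Test) : laplace f ∈ Y := by
  refine ⟨laplace_differentiable f, ?_⟩
  obtain ⟨a, b, ha, hab⟩ : ∃ a b : ℝ, 0 < a ∧ ∀ t ∈ tsupport f, a ≤ t ∧ t ≤ b := by
    rcases (tsupport f).eq_empty_or_nonempty with h | h
    · exact ⟨1, 1, one_pos, by simp [h]⟩
    · obtain ⟨a, ha, ha'⟩ := f.hasCompactSupport.isCompact.exists_isLeast h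
      obtain ⟨b, hb, hb'⟩ := f.hasCompactSupport.isCompact.exists_isGreatest h
      exact ⟨a, b, f.tsupport_subset ha, fun t ht => ⟨ha' ht, hb' ht⟩⟩
  let A : ℕ → ℝ := fun n => ∫ t : ℝ, ‖(Test.deriv^[n] f) t‖
  have hA : ∀ n, 0 ≤ A n := fun n => integral_nonneg fun t => norm_nonneg _
  refine ⟨-a, b, fun n => 2 ^ n * (A 0 + A n), by linarith, fun n z => ?_⟩
  have h0 := laplace_norm_le f (a := a) (b := b)
    (fun t ht => hab t (subset_tsupport _ ht)) z
  have hn := laplace_norm_le (Test.deriv^[n] f) (a := a) (b := b)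
    (fun t ht => hab t (f.iterate_deriv_tsupport n (subset_tsupport _ ht))) z
  rw [laplace_iter, norm_mul, norm_pow] at hn
  have key : ∀ E : ℝ, ‖laplace f z‖ ≤ A 0 * E → ‖z‖ ^ n * ‖laplace f z‖ ≤ A n * E →
      ‖laplace f z‖ ≤ 2 ^ n * (A 0 + A n) * ((1 + ‖z‖) ^ n)⁻¹ * E := by
    intro E e1 e2
    have hpos : 0 < (1 + ‖z‖) ^ n := by positivity
    rw [mul_right_comm, ← div_eq_mul_inv, le_div_iff₀ hpos]
    have hp : (1 + ‖z‖) ^ n ≤ 2 ^ n * (1 + ‖z‖ ^ n) := by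
      rcases le_total ‖z‖ 1 with h | h
      · calc (1 + ‖z‖) ^ n ≤ 2 ^ n := by gcongr; linarith
          _ ≤ 2 ^ n * (1 + ‖z‖ ^ n) := by
            have : 0 ≤ ‖z‖ ^ n := by positivity
            have : (0 : ℝ) < 2 ^ n := by positivity
            nlinarith
      · calc (1 + ‖z‖) ^ n ≤ (2 * ‖z‖) ^ n := by gcongr; linarith
          _ = 2 ^ n * ‖z‖ ^ n := mul_pow _ _ _
          _ ≤ 2 ^ n * (1 + ‖z‖ ^ n) := by gcongr; linarith
    calc ‖laplace f z‖ * (1 + ‖z‖) ^ n ≤ ‖laplace f z‖ * (2 ^ n * (1 + ‖z‖ ^ n)) := by gcongr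
      _ = 2 ^ n * (‖laplace f z‖ + ‖z‖ ^ n * ‖laplace f z‖) := by ring
      _ ≤ 2 ^ n * (A 0 * E + A n * E) := by gcongr
      _ = 2 ^ n * (A 0 + A n) * E := by ring
  exact ⟨fun hz => key _ (h0.1 hz) (hn.1 hz), fun hz => key _ (h0.2 hz) (hn.2 hz)⟩

/-- The Laplace transform as a map `L : C₀^∞(ℝ₊) → 𝒴`. -/
def laplaceY (f : Test) : Y := ⟨laplace f, laplace_mem f⟩

/-- `σ ∈ 𝒴'` is the sigma-function of `h ∈ C₀^∞(ℝ₊)'`: `h = L* σ`, i.e.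
`⟨h, F⟩ = ⟨σ, L F⟩` for all `F ∈ C₀^∞(ℝ₊)`. -/
def IsSigmaFunction (h : TestDual) (σ : YDual) : Prop :=
  ∀ F : Test, h F = σ (laplaceY F)

/-! ### The space `𝒮₀` and its dual -/

/-- The space `𝒮₀` of functions `g ∈ C^∞(ℝ₊)` with
`|g⁽ᵏ⁾(x)| ≤ C_{ϰ,k} x^{-1/2-k} (1 + |ln x|)^{-ϰ}` for all `k ≥ 0` and all real `ϰ`.
A function on `(0, ∞)` is represented by its extension by zero to `ℝ`. -/
def S0 : Submodule ℂ (ℝ → ℂ) where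
  carrier := {g | (∀ x ≤ 0, g x = 0) ∧ ContDiffOn ℝ ∞ g (Ioi 0) ∧
    ∀ (k : ℕ) (ϰ : ℝ), ∃ C : ℝ, ∀ x : ℝ, 0 < x →
      ‖iteratedDeriv k g x‖ ≤ C * x ^ (-1 / 2 - (k : ℝ)) * (1 + |Real.log x|) ^ (-ϰ)}
  zero_mem' := by
    refine ⟨fun _ _ => rfl, contDiffOn_const, fun k ϰ => ⟨0, fun x _ => ?_⟩⟩
    have : iteratedDeriv k (0 : ℝ → ℂ) x = 0 := by
      simp
    simp [this]
  add_mem' := by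
    rintro f g ⟨hf0, hf, hfb⟩ ⟨hg0, hg, hgb⟩
    refine ⟨fun x hx => by simp [hf0 x hx, hg0 x hx], hf.add hg, fun k ϰ => ?_⟩
    obtain ⟨C, hC⟩ := hfb k ϰ
    obtain ⟨D, hD⟩ := hgb k ϰ
    refine ⟨C + D, fun x hx => ?_⟩
    have hfx : ContDiffAt ℝ k f x :=
      ((hf.contDiffAt (Ioi_mem_nhds hx)).of_le (by exact_mod_cast le_top))
    have hgx : ContDiffAt ℝ k g x :=
      ((hg.contDiffAt (Ioi_mem_nhds hx)).of_le (by exact_mod_cast le_top))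
    rw [iteratedDeriv_add hfx hgx]
    refine (norm_add_le _ _).trans ((add_le_add (hC x hx) (hD x hx)).trans_eq ?_)
    ring
  smul_mem' := by
    rintro c f ⟨hf0, hf, hfb⟩
    refine ⟨fun x hx => by simp [hf0 x hx], hf.const_smul c, fun k ϰ => ?_⟩
    obtain ⟨C, hC⟩ := hfb k ϰ
    refine ⟨‖c‖ * C, fun x hx => ?_⟩
    rw [iteratedDeriv_const_smul_field, norm_smul, mul_assoc, mul_assoc, ← mul_assoc C]
    have := hC x hx
    gcongr

/-- `𝒮₀'`: antilinear functionals on `𝒮₀` that are continuous for the Fréchet topology given by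
the best constants in the defining estimates of `𝒮₀`. Explicitly: for some `n` and `M`, whenever
the estimates with `k ≤ n` and `ϰ = n` hold for `g` with a common constant `B`, one has
`|⟨τ, g⟩| ≤ M B`. -/
structure S0Dual where
  /-- the underlying antilinear functional -/
  toFun : S0 →ₛₗ[starRingEnd ℂ] ℂ
  bound' : ∃ (n : ℕ) (M : ℝ), ∀ (g : S0) (B : ℝ),
    (∀ k ≤ n, ∀ x : ℝ, 0 < x →
      ‖iteratedDeriv k (g : ℝ → ℂ) x‖ ≤
        B * x ^ (-1 / 2 - (k : ℝ)) * (1 + |Real.log x|) ^ (-(n : ℝ))) →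
    ‖toFun g‖ ≤ M * B

instance : CoeFun S0Dual (fun _ => S0 → ℂ) := ⟨fun τ => τ.toFun⟩

lemma Test.iterate_deriv_coe (f : Test) (n : ℕ) :
    ((Test.deriv^[n] f : Test) : ℝ → ℂ) = iteratedDeriv n f := by
  induction n with
  | zero => simp
  | succ n ih =>
    rw [Function.iterate_succ_apply', iteratedDeriv_succ, ← ih]
    rfl

lemma Test.mem_S0 (f : Test) : (f : ℝ → ℂ) ∈ S0 := by
  refine ⟨fun x hx => f.eq_zero hx, ContDiff.contDiffOn f.contDiff, fun k ϰ => ?_⟩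
  have hpos : ∀ x ∈ tsupport f, (0 : ℝ) < x := fun x hx => f.tsupport_subset hx
  have hcont : ContinuousOn (fun x : ℝ =>
      ‖(Test.deriv^[k] f) x‖ / (x ^ (-1 / 2 - (k : ℝ)) * (1 + |Real.log x|) ^ (-ϰ)))
      (tsupport f) := by
    have h1 : ContinuousOn (fun x : ℝ => ‖(Test.deriv^[k] f) x‖) (tsupport f) :=
      (Test.deriv^[k] f).continuous.norm.continuousOn
    have h2 : ContinuousOn (fun x : ℝ => x ^ (-1 / 2 - (k : ℝ))) (tsupport f) :=
      fun x hx => (Real.continuousAt_rpow_const x _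
        (Or.inl (hpos x hx).ne')).continuousWithinAt
    have h3 : ContinuousOn (fun x : ℝ => 1 + |Real.log x|) (tsupport f) :=
      continuousOn_const.add
        (Real.continuousOn_log.mono fun x hx => (hpos x hx).ne').abs
    have h4 : ContinuousOn (fun x : ℝ => (1 + |Real.log x|) ^ (-ϰ)) (tsupport f) :=
      h3.rpow_const fun x _ => Or.inl (by positivity)
    refine h1.div (h2.mul h4) fun x hx => ?_
    have := hpos x hx
    positivity
  obtain ⟨C, hC⟩ := f.hasCompactSupport.isCompact.exists_bound_of_continuousOn hcont
  refine ⟨max C 0, fun x hx => ?_⟩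
  rw [mul_assoc, ← f.iterate_deriv_coe]
  have hw : 0 < x ^ (-1 / 2 - (k : ℝ)) * (1 + |Real.log x|) ^ (-ϰ) := by positivity
  by_cases hs : x ∈ tsupport f
  · rw [← div_le_iff₀ hw]
    exact ((Real.le_norm_self _).trans (hC x hs)).trans (le_max_left _ _)
  · have : (Test.deriv^[k] f) x = 0 := by
      by_contra h
      exact hs (f.iterate_deriv_tsupport k (subset_tsupport _ h))
    rw [this, norm_zero]
    have : 0 ≤ max C 0 := le_max_right _ _
    positivity

/-- The inclusion `C₀^∞(ℝ₊) ⊂ 𝒮₀`. -/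
def Test.toS0 (f : Test) : S0 := ⟨f, f.mem_S0⟩

lemma one_add_abs_log_rpow_le (k : ℕ) (ϰ : ℝ) : ∃ C : ℝ, 0 ≤ C ∧ ∀ x : ℝ, 0 < x →
    x ^ (1 / 2 + (k : ℝ)) * (1 + |Real.log x|) ^ ϰ ≤ C * (1 + x ^ (k + 1)) := by
  obtain ⟨m, hm⟩ := exists_nat_ge ϰ
  refine ⟨(2 * (m + 1)) ^ m * Real.exp (1 / 2), by positivity, fun x hx => ?_⟩
  set u := Real.log x with hu
  have hxu : x = Real.exp u := (Real.exp_log hx).symm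
  have h1 : (1 + |u|) ^ ϰ ≤ (1 + |u|) ^ m := by
    rw [← Real.rpow_natCast]
    exact Real.rpow_le_rpow_of_exponent_le (by linarith [abs_nonneg u]) hm
  have h2 : (1 + |u|) ^ m ≤ (2 * (m + 1)) ^ m * Real.exp ((1 + |u|) / 2) := by
    have hm1 : (0 : ℝ) < 2 * (m + 1) := by positivity
    have h3 : 1 + |u| ≤ 2 * (m + 1) * Real.exp ((1 + |u|) / (2 * (m + 1))) := by
      have := Real.add_one_le_exp ((1 + |u|) / (2 * (m + 1)))
      have h4 : (1 + |u|) / (2 * (m + 1)) ≤ Real.exp ((1 + |u|) / (2 * (m + 1))) := by linarith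
      rw [div_le_iff₀ hm1] at h4
      linarith
    calc (1 + |u|) ^ m ≤ (2 * (m + 1) * Real.exp ((1 + |u|) / (2 * (m + 1)))) ^ m := by gcongr
      _ = (2 * (m + 1)) ^ m * Real.exp (m * ((1 + |u|) / (2 * (m + 1)))) := by
        rw [mul_pow, ← Real.exp_nat_mul]
      _ ≤ (2 * (m + 1)) ^ m * Real.exp ((1 + |u|) / 2) := by
        have : (m : ℝ) * ((1 + |u|) / (2 * (m + 1))) ≤ (1 + |u|) / 2 := by
          rw [← mul_div_assoc, div_le_div_iff₀ hm1 two_pos]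
          nlinarith [abs_nonneg u]
        gcongr
  have h5 : x ^ (1 / 2 + (k : ℝ)) * Real.exp ((1 + |u|) / 2) ≤
      Real.exp (1 / 2) * (1 + x ^ (k + 1)) := by
    have e1 : x ^ (1 / 2 + (k : ℝ)) = Real.exp (u * (1 / 2 + k)) := by
      rw [Real.rpow_def_of_pos hx]
    have e2 : x ^ (k + 1) = Real.exp (((k + 1 : ℕ) : ℝ) * u) := by
      rw [Real.exp_nat_mul, ← hxu]
    rw [e1, e2, ← Real.exp_add]
    rcases le_total 0 u with h | h
    · rw [abs_of_nonneg h]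
      have : Real.exp (u * (1 / 2 + k) + (1 + u) / 2) =
          Real.exp (1 / 2) * Real.exp (((k + 1 : ℕ) : ℝ) * u) := by
        rw [← Real.exp_add]
        congr 1
        push_cast
        ring
      rw [this]
      have := Real.exp_pos (1 / 2)
      nlinarith
    · rw [abs_of_nonpos h]
      have : Real.exp (u * (1 / 2 + k) + (1 + -u) / 2) ≤ Real.exp (1 / 2) := by
        apply Real.exp_le_exp.2
        have : u * k ≤ 0 := mul_nonpos_of_nonpos_of_nonneg h (Nat.cast_nonneg k)
        nlinarith
      have h6 := Real.exp_pos (1 / 2)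
      have h7 := Real.exp_pos (((k + 1 : ℕ) : ℝ) * u)
      nlinarith
  calc x ^ (1 / 2 + (k : ℝ)) * (1 + |u|) ^ ϰ
      ≤ x ^ (1 / 2 + (k : ℝ)) * ((2 * (m + 1)) ^ m * Real.exp ((1 + |u|) / 2)) := by
        gcongr
        exact h1.trans h2
    _ = (2 * (m + 1)) ^ m * (x ^ (1 / 2 + (k : ℝ)) * Real.exp ((1 + |u|) / 2)) := by ring
    _ ≤ (2 * (m + 1)) ^ m * (Real.exp (1 / 2) * (1 + x ^ (k + 1))) := by gcongr
    _ = _ := by ring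

lemma pow_mul_exp_neg_le (k : ℕ) {r x : ℝ} (hr : r < 0) (hx : 0 ≤ x) :
    x ^ k * Real.exp (r * x) ≤ k.factorial / (-r) ^ k := by
  have hr' : 0 < -r := by linarith
  have h := Real.pow_div_factorial_le_exp (x := -r * x) (by positivity) k
  rw [div_le_iff₀ (by positivity), mul_pow] at h
  rw [le_div_iff₀ (by positivity)]
  have h2 : Real.exp (r * x) * Real.exp (-r * x) = 1 := by
    rw [← Real.exp_add]; simp
  calc x ^ k * Real.exp (r * x) * (-r) ^ k = Real.exp (r * x) * ((-r) ^ k * x ^ k) := by ring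
    _ ≤ Real.exp (r * x) * (Real.exp (-r * x) * k.factorial) := by gcongr
    _ = k.factorial := by rw [← mul_assoc, h2, one_mul]

lemma iteratedDeriv_comp_ofReal {w : ℂ → ℂ} (hw : Differentiable ℂ w) (k : ℕ) :
    iteratedDeriv k (fun x : ℝ => w (x : ℂ)) = fun x : ℝ => iteratedDeriv k w (x : ℂ) := by
  induction k with
  | zero => simp
  | succ k ih =>
    rw [iteratedDeriv_succ, ih, iteratedDeriv_succ]
    funext x
    have hd : Differentiable ℂ (iteratedDeriv k w) :=
      (hw.contDiff (n := ω)).differentiable_iteratedDeriv k (by exact WithTop.coe_lt_top _)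
    exact ((hd x).hasDerivAt.comp_ofReal).deriv

lemma Y.restrict_mem (w : Y) :
    (Ioi (0 : ℝ)).indicator (fun x : ℝ => (w : ℂ → ℂ) (x : ℂ)) ∈ S0 := by
  obtain ⟨w, hw, rp, rm, C, hr, hb⟩ := w
  have hsm : ContDiff ℝ ∞ (fun x : ℝ => w (x : ℂ)) :=
    ((hw.contDiff (n := ∞)).restrict_scalars ℝ).comp Complex.ofRealCLM.contDiff
  refine ⟨fun x hx => indicator_of_notMem (not_lt.2 hx) _,
    hsm.contDiffOn.congr fun x hx => indicator_of_mem hx _, fun k ϰ => ?_⟩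
  obtain ⟨D, hD0, hD⟩ := one_add_abs_log_rpow_le k ϰ
  have hC0 : 0 ≤ C 0 := by
    have := (norm_nonneg _).trans ((hb 0 0).1 (by simp))
    simpa using this
  let K : ℝ := k.factorial * (C 0 * Real.exp |rm|) * Real.exp (-rp)
  have hK : 0 ≤ K := by positivity
  let P : ℝ := 1 + (k + 1).factorial / (-rp) ^ (k + 1)
  have hP : ∀ x : ℝ, 0 < x → Real.exp (rp * x) * (1 + x ^ (k + 1)) ≤ P := by
    intro x hx
    have h1 := pow_mul_exp_neg_le (k + 1) hr hx.le
    have h2 : Real.exp (rp * x) ≤ 1 := Real.exp_le_one_iff.2 (by nlinarith)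
    calc Real.exp (rp * x) * (1 + x ^ (k + 1))
        = Real.exp (rp * x) + x ^ (k + 1) * Real.exp (rp * x) := by ring
      _ ≤ P := add_le_add h2 h1
  refine ⟨K * D * P, fun x hx => ?_⟩
  have hev : (Ioi (0 : ℝ)).indicator (fun x : ℝ => w (x : ℂ)) =ᶠ[𝓝 x]
      fun x : ℝ => w (x : ℂ) := by
    filter_upwards [Ioi_mem_nhds hx] with y hy
    exact indicator_of_mem hy _
  have hder : ‖iteratedDeriv k w (x : ℂ)‖ ≤ K * Real.exp (rp * x) := by
    have hs : ∀ z ∈ Metric.sphere (x : ℂ) 1,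
        ‖w z‖ ≤ C 0 * Real.exp |rm| * Real.exp (rp * (x - 1)) := by
      intro z hz
      have hre : |z.re - x| ≤ 1 := by
        have := Complex.abs_re_le_norm (z - x)
        rw [mem_sphere_iff_norm.1 hz] at this
        simpa using this
      rw [abs_le] at hre
      rcases le_total 0 z.re with h | h
      · refine ((hb 0 z).1 h).trans ?_
        rw [abs_of_nonneg h, pow_zero, inv_one, mul_one]
        have h1 : Real.exp (rp * z.re) ≤ Real.exp (rp * (x - 1)) :=
          Real.exp_le_exp.2 (by nlinarith)
        have h2 : 1 ≤ Real.exp |rm| := Real.one_le_exp (abs_nonneg _)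
        calc C 0 * Real.exp (rp * z.re) ≤ C 0 * Real.exp (rp * (x - 1)) := by gcongr
          _ ≤ C 0 * Real.exp |rm| * Real.exp (rp * (x - 1)) := by
            gcongr
            nlinarith
      · refine ((hb 0 z).2 h).trans ?_
        rw [pow_zero, inv_one, mul_one]
        have h1 : Real.exp (rm * |z.re|) ≤ Real.exp |rm| := by
          apply Real.exp_le_exp.2
          rw [abs_of_nonpos h]
          nlinarith [le_abs_self rm, abs_nonneg rm]
        have h2 : 1 ≤ Real.exp (rp * (x - 1)) := Real.one_le_exp (by nlinarith)
        calc C 0 * Real.exp (rm * |z.re|) ≤ C 0 * Real.exp |rm| := by gcongr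
          _ ≤ C 0 * Real.exp |rm| * Real.exp (rp * (x - 1)) :=
            le_mul_of_one_le_right (by positivity) h2
    have := Complex.norm_iteratedDeriv_le_of_forall_mem_sphere_norm_le k one_pos
      hw.diffContOnCl hs
    rw [one_pow, div_one] at this
    refine this.trans_eq ?_
    have he : Real.exp (rp * (x - 1)) = Real.exp (-rp) * Real.exp (rp * x) := by
      rw [← Real.exp_add]; congr 1; ring
    rw [he]
    ring
  have hlog : 0 < 1 + |Real.log x| := by positivity
  have e1 : x ^ (-1 / 2 - (k : ℝ)) = (x ^ (1 / 2 + (k : ℝ)))⁻¹ := by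
    rw [← Real.rpow_neg hx.le]; congr 1; ring
  have e2 : (1 + |Real.log x|) ^ (-ϰ) = ((1 + |Real.log x|) ^ ϰ)⁻¹ := Real.rpow_neg hlog.le _
  change ‖iteratedDeriv k ((Ioi (0 : ℝ)).indicator (fun x : ℝ => w (x : ℂ))) x‖ ≤ _
  rw [hev.iteratedDeriv_eq k, iteratedDeriv_comp_ofReal hw, e1, e2, mul_assoc, ← mul_inv,
    ← div_eq_mul_inv, le_div_iff₀ (by positivity)]
  calc ‖iteratedDeriv k w (x : ℂ)‖ * (x ^ (1 / 2 + (k : ℝ)) * (1 + |Real.log x|) ^ ϰ)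
      ≤ K * Real.exp (rp * x) * (D * (1 + x ^ (k + 1))) := by
        exact mul_le_mul hder (hD x hx) (by positivity) (by positivity)
    _ = K * D * (Real.exp (rp * x) * (1 + x ^ (k + 1))) := by ring
    _ ≤ K * D * P := by
        gcongr
        exact hP x hx

/-- The restriction of `w ∈ 𝒴` to `ℝ₊`, an element of `𝒮₀`. -/
def Y.restrict (w : Y) : S0 :=
  ⟨(Ioi (0 : ℝ)).indicator (fun x : ℝ => (w : ℂ → ℂ) (x : ℂ)), Y.restrict_mem w⟩

/-- The functional `σ ∈ 𝒴'` is supported in `[0, ∞)` and belongs to `𝒮₀'`: it is given by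
`τ ∈ 𝒮₀'` through restriction of the test functions `w ∈ 𝒴` to `ℝ₊`,
`⟨σ, w⟩ = ⟨τ, w|_{ℝ₊}⟩`. -/
def IsGivenBy (σ : YDual) (τ : S0Dual) : Prop :=
  ∀ w : Y, σ w = τ (Y.restrict w)

/-! ### Quadratic forms and the numbers `N_±` -/

/-- The form `h[f, f] = ⟨h, f̄ ⋆ f⟩` on `C₀^∞(ℝ₊)`. -/
def hankelForm (h : TestDual) (f : Test) : ℂ := h (f.conj.laplaceConv f)

/-- The form `τ[w, w] = ⟨τ, w̄ w⟩` on `C₀^∞(ℝ₊)`. -/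
def sigmaForm (τ : S0Dual) (w : Test) : ℂ := τ (w.conj.mul w).toS0

/-- `N₊(q; D) ∈ {0, 1, 2, …, ∞}`: the maximal dimension of linear sets `M ⊆ D` with
`q φ > 0` for all nonzero `φ ∈ M`. The form `q` is real-valued; a complex-valued form enters
through its real part, which for a real distribution is the form itself. -/
def Npos {D : Type*} [AddCommGroup D] [Module ℂ D] (q : D → ℝ) : ℕ∞ :=
  ⨆ M : {M : Submodule ℂ D // ∀ φ ∈ M, φ ≠ 0 → 0 < q φ},
    Cardinal.toENat (Module.rank ℂ M.1)

/-- `N₋(q; D) ∈ {0, 1, 2, …, ∞}`: the maximal dimension of linear sets `M ⊆ D` with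
`-q φ > 0` for all nonzero `φ ∈ M`. -/
def Nneg {D : Type*} [AddCommGroup D] [Module ℂ D] (q : D → ℝ) : ℕ∞ :=
  Npos fun φ => -q φ

/-! ### Sign of a distribution and distributions given by a function on an interval -/

/-- `τ ≥ 0` on `ℝ₊` in the sense of distributions. -/
def S0Dual.Nonneg (τ : S0Dual) : Prop :=
  ∀ φ : Test, (∀ x, 0 ≤ φ x) → 0 ≤ τ φ.toS0

/-- `-τ ≥ 0` on `ℝ₊` in the sense of distributions. -/
def S0Dual.Nonpos (τ : S0Dual) : Prop :=
  ∀ φ : Test, (∀ x, 0 ≤ φ x) → τ φ.toS0 ≤ 0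

/-- On the interval `(a, b)` the distribution `τ` is the real function `s ∈ L¹_loc(a, b)`. -/
def S0Dual.EqFunOn (τ : S0Dual) (s : ℝ → ℝ) (a b : ℝ) : Prop :=
  LocallyIntegrableOn s (Ioo a b) ∧
  ∀ φ : Test, tsupport φ ⊆ Ioo a b →
    τ φ.toS0 = ∫ x, (s x : ℂ) * (starRingEnd ℂ) (φ x)

end HankelSigma
end

open HankelSigma

/-! Both forms are restrictions of one continuous quadratic form on the Schwartz space, each to a
dense subspace. The bounds defining `S0` say that `g(λ) = λ^{-1/2} v(-ln λ)` with `v` a Schwartz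
function on `ℝ`. Hence `q(u) = ⟨τ, λ^{-1/2} |u(-ln λ)|²⟩` (`schwartzForm`) is defined and continuous
on `𝓢(ℝ, ℂ)`. Splitting the weight evenly between the two factors gives `sigmaForm τ w = q(u)` for
`u(x) = e^{-x/4} w(e^{-x})`. The Laplace transform takes `f̄ ⋆ f` to `|L f|²` on the half-line, so
that also `hankelForm h f = q(u)` for `u(x) = e^{-x/4} (L f)(e^{-x})` (`sigmaForm_eq`,
`hankelForm_eq`).

The first family of `u` contains every compactly supported smooth function, so it is dense. The
second consists of the convolutions of `e^{3x/4} f(e^x)` with the fixed Schwartz kernel `e^{-x/4}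
exp(-e^{-x})`. The Fourier transform of this kernel is `Γ(1/4 + 2πiξ)`, which has no zeros, so
convolution with it has dense range (`denseRange_convolution_mul`) and the second family is dense
too.

Positivity on a finite-dimensional space survives small perturbations of a basis, because the unit
sphere is compact. Therefore `Re q` and `-Re q` have the same number of positive squares on any two
dense ranges (`Npos_comp_eq_of_denseRange`). A sign of `q` passes from one dense range to the other
by continuity. A lower bound for `σ` on an interval makes `σ[w, w]` definite on the
infinite-dimensional space of test functions supported there. -/

noncomputable section

open scoped SchwartzMap FourierTransform

/-! ### Products, density and convolution in the Schwartz space -/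

namespace SchwartzMap

lemma seminorm_pairing_mul_le (k n : ℕ) (f g : 𝓢(ℝ, ℂ)) :
    SchwartzMap.seminorm ℂ k n (pairing (ContinuousLinearMap.mul ℂ ℂ) f g) ≤
      ∑ i ∈ Finset.range (n + 1), n.choose i *
        (SchwartzMap.seminorm ℂ k i f * SchwartzMap.seminorm ℂ 0 (n - i) g) := by
  refine seminorm_le_bound' ℂ k n _ (by positivity) fun x => ?_
  have hf : ContDiffAt ℝ n f x := (f.smooth n).contDiffAt
  have hg : ContDiffAt ℝ n g x := (g.smooth n).contDiffAt
  have h : (pairing (ContinuousLinearMap.mul ℂ ℂ) f g : ℝ → ℂ) = (f : ℝ → ℂ) * g := rfl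
  rw [h, iteratedDeriv_mul hf hg]
  refine (mul_le_mul_of_nonneg_left (norm_sum_le _ _) (by positivity)).trans ?_
  rw [Finset.mul_sum]
  refine Finset.sum_le_sum fun i _ => ?_
  have h1 := le_seminorm' ℂ k i f x
  have h2 := le_seminorm' ℂ 0 (n - i) g x
  rw [pow_zero, one_mul] at h2
  rw [norm_mul, norm_mul, Complex.norm_natCast]
  calc |x| ^ k * (n.choose i * ‖iteratedDeriv i f x‖ * ‖iteratedDeriv (n - i) g x‖)
      = n.choose i * ((|x| ^ k * ‖iteratedDeriv i f x‖) * ‖iteratedDeriv (n - i) g x‖) := by ring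
    _ ≤ _ := by gcongr

lemma continuous_seminorm (k n : ℕ) :
    Continuous fun f : 𝓢(ℝ, ℂ) => SchwartzMap.seminorm ℂ k n f :=
  (schwartz_withSeminorms ℂ ℝ ℂ).continuous_seminorm (k, n)

/-- The pointwise product of Schwartz functions is jointly continuous. -/
lemma continuous_pairing_mul :
    Continuous fun p : 𝓢(ℝ, ℂ) × 𝓢(ℝ, ℂ) => pairing (ContinuousLinearMap.mul ℂ ℂ) p.1 p.2 := by
  -- For a biadditive map, joint continuity follows from continuity at the origin together with
  -- separate continuity at zero in each variable.
  let B : 𝓢(ℝ, ℂ) →+ 𝓢(ℝ, ℂ) →+ 𝓢(ℝ, ℂ) :=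
    AddMonoidHom.mk' (fun f =>
      ((pairing (ContinuousLinearMap.mul ℂ ℂ) f : 𝓢(ℝ, ℂ) →L[ℂ] 𝓢(ℝ, ℂ)) :
        𝓢(ℝ, ℂ) →ₗ[ℂ] 𝓢(ℝ, ℂ)).toAddMonoidHom)
      (fun f g => by ext h; simp)
  refine continuous_of_continuousAt_zero₂ B ?_ ?_ ?_
  · change Tendsto _ _ (𝓝 (pairing (ContinuousLinearMap.mul ℂ ℂ) (0 : 𝓢(ℝ, ℂ)) 0))
    rw [map_zero, (schwartz_withSeminorms ℂ ℝ ℂ).tendsto_nhds _ _]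
    rintro ⟨k, n⟩ ε hε
    have hc : Continuous fun p : 𝓢(ℝ, ℂ) × 𝓢(ℝ, ℂ) =>
        ∑ i ∈ Finset.range (n + 1), (n.choose i : ℝ) *
        (SchwartzMap.seminorm ℂ k i p.1 * SchwartzMap.seminorm ℂ 0 (n - i) p.2) :=
      continuous_finsetSum _ fun i _ => continuous_const.mul
        (((continuous_seminorm k i).comp continuous_fst).mul
          ((continuous_seminorm 0 (n - i)).comp continuous_snd))
    have := hc.tendsto (0, 0)
    simp only [map_zero, mul_zero, Finset.sum_const_zero] at this
    filter_upwards [this.eventually (gt_mem_nhds hε)] with p hp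
    rw [sub_zero]
    exact (seminorm_pairing_mul_le k n p.1 p.2).trans_lt hp
  · exact fun f => (pairing (ContinuousLinearMap.mul ℂ ℂ) f).continuous.continuousAt
  · exact fun g => (pairing_continuous_left (ContinuousLinearMap.mul ℂ ℂ) g).continuousAt

/-- Compactly supported functions are dense in the Schwartz space. -/
lemma dense_hasCompactSupport : Dense {g : 𝓢(ℝ, ℂ) | HasCompactSupport g} := by
  intro f
  let b : ContDiffBump (0 : ℝ) := ⟨1, 2, one_pos, one_lt_two⟩
  let χ : ℝ → ℂ := fun x => (b x : ℂ)
  have hχ : ContDiff ℝ ∞ χ := Complex.ofRealCLM.contDiff.comp b.contDiff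
  have hχs : HasCompactSupport χ :=
    b.hasCompactSupport.comp_left (g := fun r : ℝ => (r : ℂ)) Complex.ofReal_zero
  -- The error of the cutoff `χ(x/(n+1)) f` is `ψ(x/(n+1)) f`, and `ψ` vanishes with all its
  -- derivatives near every point of `(-1, 1)`.
  let ψ : ℝ → ℂ := fun x => χ x - 1
  have hψ : ContDiff ℝ ∞ ψ := hχ.sub contDiff_const
  have hψ0 : ∀ j, ∀ y : ℝ, |y| < 1 → iteratedDeriv j ψ y = 0 := by
    intro j y hy
    have : ψ =ᶠ[𝓝 y] fun _ => (0 : ℂ) := by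
      have hmem : Metric.ball (0 : ℝ) 1 ∈ 𝓝 y := Metric.isOpen_ball.mem_nhds (by simpa using hy)
      filter_upwards [hmem] with z hz
      have : b z = 1 := b.one_of_mem_closedBall (Metric.ball_subset_closedBall hz)
      simp [ψ, χ, this]
    rw [this.iteratedDeriv_eq j]
    simp
  have hA : ∀ j, ∃ A : ℝ, 0 ≤ A ∧ ∀ y, ‖iteratedDeriv j ψ y‖ ≤ A := by
    intro j
    refine ⟨SchwartzMap.seminorm ℂ 0 j (hχs.toSchwartzMap hχ) + 1, by positivity, fun y => ?_⟩
    have h1 : iteratedDeriv j ψ y = iteratedDeriv j χ y - iteratedDeriv j (fun _ => (1 : ℂ)) y :=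
      iteratedDeriv_fun_sub (hχ.contDiffAt.of_le (by exact_mod_cast le_top))
        contDiffAt_const
    rw [h1]
    refine (norm_sub_le _ _).trans (add_le_add ?_ ?_)
    · have := le_seminorm' ℂ 0 j (hχs.toSchwartzMap hχ) y
      rwa [pow_zero, one_mul] at this
    · rw [iteratedDeriv_const]
      split_ifs <;> simp
  choose A hA0 hA using hA
  have hcs : ∀ n : ℕ, ((n : ℝ) + 1)⁻¹ ≠ 0 := fun n => by positivity
  let χn : ℕ → 𝓢(ℝ, ℂ) := fun n =>
    HasCompactSupport.toSchwartzMap (f := fun x => χ (((n : ℝ) + 1)⁻¹ * x))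
      (hχs.comp_homeomorph (Homeomorph.mulLeft₀ _ (hcs n)))
      (hχ.comp (contDiff_const.mul contDiff_id))
  refine mem_closure_of_tendsto (b := atTop)
    (f := fun n : ℕ => pairing (ContinuousLinearMap.mul ℂ ℂ) (χn n) f) ?_
    (Eventually.of_forall fun n => ?_)
  · rw [(schwartz_withSeminorms ℂ ℝ ℂ).tendsto_nhds _ _]
    rintro ⟨k, m⟩ ε hε
    -- Where `ψ(cx)` is not zero one has `1 ≤ c|x|`. Spending one extra power of `|x|`, hence the
    -- index `k + 1`, gains the factor `c = 1/(n+1)`.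
    let S : ℝ := ∑ i ∈ Finset.range (m + 1),
      (m.choose i : ℝ) * (A i * SchwartzMap.seminorm ℂ (k + 1) (m - i) f)
    have hS : 0 ≤ S := Finset.sum_nonneg fun i _ => by have := hA0 i; positivity
    have hlim : Tendsto (fun n : ℕ => ((n : ℝ) + 1)⁻¹ * S) atTop (𝓝 0) := by
      have := (tendsto_one_div_add_atTop_nhds_zero_nat (𝕜 := ℝ)).mul_const S
      simpa using this
    filter_upwards [hlim.eventually (gt_mem_nhds hε)] with n hn
    refine lt_of_le_of_lt (seminorm_le_bound' ℂ k m _ (by positivity) fun x => ?_) hn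
    set c : ℝ := ((n : ℝ) + 1)⁻¹ with hc
    have hc0 : 0 < c := by positivity
    have hc1 : c ≤ 1 := inv_le_one_of_one_le₀ (by linarith [(Nat.cast_nonneg n : (0 : ℝ) ≤ n)])
    have hfun : ((pairing (ContinuousLinearMap.mul ℂ ℂ) (χn n) f - f : 𝓢(ℝ, ℂ)) : ℝ → ℂ) =
        (fun x => ψ (c * x)) * f := by
      funext y
      change χ (c * y) * f y - f y = (χ (c * y) - 1) * f y
      ring
    have hψc : ContDiff ℝ ∞ fun x : ℝ => ψ (c * x) := hψ.comp (contDiff_const.mul contDiff_id)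
    rw [hfun, iteratedDeriv_mul (hψc.contDiffAt.of_le (by exact_mod_cast le_top))
      (f.smooth m).contDiffAt]
    refine (mul_le_mul_of_nonneg_left (norm_sum_le _ _) (by positivity)).trans ?_
    rw [Finset.mul_sum, Finset.mul_sum]
    refine Finset.sum_le_sum fun i _ => ?_
    have hder : iteratedDeriv i (fun x => ψ (c * x)) x = c ^ i • iteratedDeriv i ψ (c * x) := by
      rw [iteratedDeriv_comp_const_smul (hψ.of_le (by exact_mod_cast le_top))]
    rw [hder, norm_mul, norm_mul, norm_smul, Complex.norm_natCast]
    have hs := le_seminorm' ℂ (k + 1) (m - i) f x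
    have hAi := hA0 i
    rcases lt_or_ge |c * x| 1 with h | h
    · rw [hψ0 i _ h]
      simp only [norm_zero, mul_zero, zero_mul]
      positivity
    · rw [abs_mul, abs_of_pos hc0] at h
      have h2 : ‖c ^ i‖ ≤ 1 := by
        rw [norm_pow, Real.norm_of_nonneg hc0.le]
        exact pow_le_one₀ hc0.le hc1
      calc |x| ^ k * (m.choose i * (‖c ^ i‖ * ‖iteratedDeriv i ψ (c * x)‖) *
            ‖iteratedDeriv (m - i) f x‖)
          ≤ |x| ^ k * (m.choose i * (1 * A i) * ‖iteratedDeriv (m - i) f x‖) := by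
            gcongr
            exact hA i _
        _ = m.choose i * (A i * (1 * (|x| ^ k * ‖iteratedDeriv (m - i) f x‖))) := by ring
        _ ≤ m.choose i * (A i * ((c * |x|) * (|x| ^ k * ‖iteratedDeriv (m - i) f x‖))) := by
            gcongr
        _ = c * (m.choose i * (A i * (|x| ^ (k + 1) * ‖iteratedDeriv (m - i) f x‖))) := by ring
        _ ≤ _ := by gcongr
  · change HasCompactSupport (fun x => χ (((n : ℝ) + 1)⁻¹ * x) * f x)
    exact (hχs.comp_homeomorph (Homeomorph.mulLeft₀ _ (hcs n))).mul_right

/-- Wiener's theorem for Schwartz functions: convolution with a function whose Fourier transform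
has no zeros has dense range. -/
lemma denseRange_convolution_mul (K : 𝓢(ℝ, ℂ)) (hK : ∀ ξ, (𝓕 K) ξ ≠ 0) :
    DenseRange (convolution (ContinuousLinearMap.mul ℂ ℂ) K : 𝓢(ℝ, ℂ) → 𝓢(ℝ, ℂ)) := by
  -- It suffices to reach the functions with compactly supported Fourier transform: for these,
  -- division by `𝓕 K` stays within smooth compactly supported functions, without any lower bound on
  -- `𝓕 K` at infinity.
  have hdense : DenseRange fun φ : {g : 𝓢(ℝ, ℂ) | HasCompactSupport g} => (𝓕⁻ φ.1 : 𝓢(ℝ, ℂ)) :=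
    DenseRange.comp (g := fun φ : 𝓢(ℝ, ℂ) => (𝓕⁻ φ : 𝓢(ℝ, ℂ)))
      (Function.Surjective.denseRange fun φ => ⟨𝓕 φ, by simp⟩)
      dense_hasCompactSupport.denseRange_val
      (FourierTransform.fourierInvCLM ℂ 𝓢(ℝ, ℂ)).continuous
  refine hdense.mono ?_
  rintro _ ⟨⟨φ, hφ⟩, rfl⟩
  have hs : HasCompactSupport fun ξ => ((𝓕 K) ξ)⁻¹ * φ ξ := HasCompactSupport.mul_left hφ
  have hd : ContDiff ℝ ∞ fun ξ => ((𝓕 K) ξ)⁻¹ * φ ξ :=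
    (ContDiff.inv ((𝓕 K).smooth ⊤) hK).mul (φ.smooth ⊤)
  set ρ : 𝓢(ℝ, ℂ) := hs.toSchwartzMap hd
  refine ⟨𝓕⁻ ρ, ?_⟩
  change (𝓕⁻ (pairing (ContinuousLinearMap.mul ℂ ℂ) (𝓕 K) (𝓕 (𝓕⁻ ρ))) : 𝓢(ℝ, ℂ)) = 𝓕⁻ φ
  congr 1
  ext ξ
  simp [ρ, mul_inv_cancel_left₀ (hK ξ)]

end SchwartzMap

end

/-! ### Positive squares of a continuous form on dense subspaces -/

namespace HankelSigma

/-- A continuous quadratic form has at least as many positive squares on the range of a linear map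
with dense range as on the range of any other linear map. -/
lemma Npos_comp_le_of_denseRange {V D₁ D₂ : Type*} [AddCommGroup V] [Module ℂ V]
    [TopologicalSpace V] [IsTopologicalAddGroup V] [ContinuousSMul ℂ V]
    [AddCommGroup D₁] [Module ℂ D₁] [AddCommGroup D₂] [Module ℂ D₂]
    {q : V → ℝ} (hq : Continuous q) (hq' : ∀ (c : ℂ) (u : V), q (c • u) = ‖c‖ ^ 2 * q u)
    (i₁ : D₁ →ₗ[ℂ] V) (i₂ : D₂ →ₗ[ℂ] V) (hi₂ : DenseRange i₂) :
    Npos (fun f => q (i₁ f)) ≤ Npos (fun f => q (i₂ f)) := by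
  -- Testing against finite `n` only also covers subspaces `M` of infinite dimension.
  refine iSup_le fun ⟨M, hM⟩ => ENat.forall_natCast_le_iff_le.1 fun n hn => ?_
  obtain ⟨e, he⟩ := exists_linearIndependent_of_le_rank (Cardinal.natCast_le_toENat.1 hn)
  have hpos : ∀ c : Fin n → ℂ, c ≠ 0 → 0 < q (∑ i, c i • i₁ (e i)) := by
    intro c hc
    have h1 : (∑ i, c i • e i : M) ≠ 0 := fun h0 =>
      hc (funext fun i => Fintype.linearIndependent_iff.1 he c h0 i)
    have := hM _ (∑ i, c i • e i : M).2 fun h0 => h1 (Subtype.ext h0)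
    simpa using this
  have hF : Continuous fun p : (Fin n → V) × (Fin n → ℂ) => q (∑ i, p.2 i • p.1 i) := by
    fun_prop
  -- Positivity is an open condition at each point of the compact coefficient sphere, so it holds on
  -- the whole sphere for all tuples near `i₁ (e i)`. One such tuple lies in the range of `i₂`.
  have hev := (isCompact_sphere (0 : Fin n → ℂ) 1).eventually_forall_of_forall_eventually
    (x₀ := fun i => i₁ (e i)) (P := fun w c => 0 < q (∑ i, c i • w i)) fun c hc =>
      hF.continuousAt.eventually (lt_mem_nhds (hpos c fun h => by simp [h] at hc))
  have hdense : DenseRange fun (w : Fin n → D₂) i => i₂ (w i) := DenseRange.piMap fun _ => hi₂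
  obtain ⟨_, ⟨w, rfl⟩, hw⟩ := Dense.inter_nhds_nonempty hdense hev
  have hw' : ∀ c : Fin n → ℂ, c ≠ 0 → 0 < q (i₂ (∑ i, c i • w i)) := by
    intro c hc
    have hc' : 0 < ‖c‖ := norm_pos_iff.2 hc
    have h1 := hw ((‖c‖⁻¹ : ℂ) • c) (by
      rw [mem_sphere_zero_iff_norm, norm_smul]
      simp [hc'.ne'])
    have h2 : ∑ i, ((‖c‖⁻¹ : ℂ) • c) i • i₂ (w i) = (‖c‖⁻¹ : ℂ) • i₂ (∑ i, c i • w i) := by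
      simp [Finset.smul_sum, smul_smul]
    rw [h2, hq'] at h1
    exact pos_of_mul_pos_right h1 (by positivity)
  -- A nontrivial relation would give `0 < q 0`, while homogeneity with the scalar `0` gives `q 0 =
  -- 0`. Thus injectivity of `i₂` is not needed.
  have hli : LinearIndependent ℂ w := by
    refine Fintype.linearIndependent_iff.2 fun c hc => ?_
    by_contra! h
    have h0 : c ≠ 0 := fun hc0 => by simp [hc0] at h
    have h1 := hw' c h0
    rw [hc, map_zero, ← zero_smul ℂ (0 : V), hq'] at h1
    simp at h1
  have hrank : Cardinal.toENat (Module.rank ℂ (Submodule.span ℂ (range w))) = n := by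
    have := FiniteDimensional.span_of_finite ℂ (finite_range w)
    rw [← Module.finrank_eq_rank, finrank_span_eq_card hli]
    simp
  rw [← hrank]
  refine le_iSup (fun M : {M : Submodule ℂ D₂ // ∀ φ ∈ M, φ ≠ 0 → 0 < q (i₂ φ)} =>
    Cardinal.toENat (Module.rank ℂ M.1)) ⟨Submodule.span ℂ (range w), fun φ hφ hφ0 => ?_⟩
  obtain ⟨c, rfl⟩ := (Submodule.mem_span_range_iff_exists_fun ℂ).1 hφ
  exact hw' c fun h => hφ0 (by simp [h])

lemma Npos_comp_eq_of_denseRange {V D₁ D₂ : Type*} [AddCommGroup V] [Module ℂ V]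
    [TopologicalSpace V] [IsTopologicalAddGroup V] [ContinuousSMul ℂ V]
    [AddCommGroup D₁] [Module ℂ D₁] [AddCommGroup D₂] [Module ℂ D₂]
    {q : V → ℝ} (hq : Continuous q) (hq' : ∀ (c : ℂ) (u : V), q (c • u) = ‖c‖ ^ 2 * q u)
    (i₁ : D₁ →ₗ[ℂ] V) (i₂ : D₂ →ₗ[ℂ] V) (hi₁ : DenseRange i₁) (hi₂ : DenseRange i₂) :
    Npos (fun f => q (i₁ f)) = Npos (fun f => q (i₂ f)) :=
  (Npos_comp_le_of_denseRange hq hq' i₁ i₂ hi₂).antisymm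
    (Npos_comp_le_of_denseRange hq hq' i₂ i₁ hi₁)

lemma Npos_eq_top {D : Type*} [AddCommGroup D] [Module ℂ D] {q : D → ℝ} (M : Submodule ℂ D)
    (hM : ∀ φ ∈ M, φ ≠ 0 → 0 < q φ) (hr : Cardinal.aleph0 ≤ Module.rank ℂ M) :
    Npos q = ⊤ := by
  refine top_unique (le_trans ?_ (le_iSup (fun M : {M : Submodule ℂ D //
    ∀ φ ∈ M, φ ≠ 0 → 0 < q φ} => Cardinal.toENat (Module.rank ℂ M.1)) ⟨M, hM⟩))
  exact (Cardinal.toENat_eq_top.2 hr).ge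

end HankelSigma

noncomputable section

open scoped SchwartzMap FourierTransform

/-! ### The exponential change of variables -/

namespace HankelSigma

lemma Test.hasCompactSupport_comp_exp (f : Test) (a : ℝ) {s : ℝ} (hs : s ≠ 0) :
    HasCompactSupport fun x : ℝ => (Real.exp (a * x) : ℂ) * f (Real.exp (s * x)) := by
  have hlog : ContinuousOn (fun t => Real.log t / s) (tsupport f) := fun t ht =>
    ((Real.continuousAt_log (ne_of_gt (f.tsupport_subset ht))).div_const s).continuousWithinAt
  refine HasCompactSupport.intro (f.hasCompactSupport.isCompact.image_of_continuousOn hlog)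
    fun x hx => ?_
  have : f (Real.exp (s * x)) = 0 := by
    by_contra h
    exact hx ⟨_, subset_tsupport _ h, by simp [hs]⟩
  rw [this, mul_zero]

/-- The linear map taking `f` to `x ↦ e^{a x} f(e^{s x})`. -/
def Test.expPullback (a : ℝ) {s : ℝ} (hs : s ≠ 0) : Test →ₗ[ℂ] 𝓢(ℝ, ℂ) where
  toFun f := (f.hasCompactSupport_comp_exp a hs).toSchwartzMap <|
    (Complex.ofRealCLM.contDiff.comp
      (Real.contDiff_exp.comp (contDiff_const.mul contDiff_id))).mul
      (ContDiff.comp f.contDiff (Real.contDiff_exp.comp (contDiff_const.mul contDiff_id)))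
  map_add' f g := by
    ext x
    simp [mul_add]
  map_smul' c f := by
    ext x
    simp [mul_left_comm]

lemma Test.expPullback_apply (a : ℝ) {s : ℝ} (hs : s ≠ 0) (f : Test) (x : ℝ) :
    Test.expPullback a hs f x = (Real.exp (a * x) : ℂ) * f (Real.exp (s * x)) := rfl

/-- The substitution `t = e^{sx}` is a diffeomorphism of `ℝ` onto the half-line and the weight is
smooth and nonvanishing, so every compactly supported smooth function on `ℝ` has a preimage. -/
lemma Test.denseRange_expPullback (a : ℝ) {s : ℝ} (hs : s ≠ 0) :
    DenseRange (Test.expPullback a hs) := by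
  refine SchwartzMap.dense_hasCompactSupport.mono fun g (hg : HasCompactSupport g) => ?_
  let F : ℝ → ℂ := (Ioi (0 : ℝ)).indicator fun t =>
    (Real.exp (-a * (Real.log t / s)) : ℂ) * g (Real.log t / s)
  let S : Set ℝ := (fun x => Real.exp (s * x)) '' tsupport g
  have hS : IsCompact S := hg.isCompact.image (by fun_prop)
  have hSpos : S ⊆ Ioi 0 := by
    rintro _ ⟨x, _, rfl⟩
    exact Real.exp_pos _
  have hzero : ∀ t ∉ S, F t = 0 := by
    intro t ht
    by_cases h0 : t ∈ Ioi (0 : ℝ)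
    · have : g (Real.log t / s) = 0 := by
        by_contra h
        exact ht ⟨_, subset_tsupport _ h, by
          simp only [mul_div_cancel₀ _ hs]
          exact Real.exp_log h0⟩
      simp [F, this]
    · exact indicator_of_notMem h0 _
  have htsupp : tsupport F ⊆ S := closure_minimal
    (fun t ht => by_contra fun h => ht (hzero t h)) hS.isClosed
  have hsmooth : ContDiff ℝ ∞ F := by
    -- Off the compact set `S` the function `F` is locally zero, and on `S ⊆ (0, ∞)` the logarithm
    -- is smooth.
    refine contDiff_iff_contDiffAt.2 fun t => ?_
    by_cases ht : t ∈ S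
    swap
    · refine contDiffAt_const (c := (0 : ℂ)) |>.congr_of_eventuallyEq ?_
      filter_upwards [hS.isClosed.isOpen_compl.mem_nhds ht] with y hy using hzero y hy
    have h0 : (0 : ℝ) < t := hSpos ht
    have hev : F =ᶠ[𝓝 t] fun t => (Real.exp (-a * (Real.log t / s)) : ℂ) * g (Real.log t / s) := by
      filter_upwards [Ioi_mem_nhds h0] with y hy
      exact indicator_of_mem hy _
    refine ContDiffAt.congr_of_eventuallyEq ?_ hev
    have hlog : ContDiffAt ℝ ∞ (fun t => Real.log t / s) t :=
      (Real.contDiffAt_log.2 h0.ne').div_const s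
    exact (Complex.ofRealCLM.contDiff.contDiffAt.comp t
      (Real.contDiff_exp.contDiffAt.comp t (contDiffAt_const.mul hlog))).mul
      (ContDiffAt.comp t (g.smooth ⊤).contDiffAt hlog)
  refine ⟨⟨F, hsmooth, HasCompactSupport.intro hS hzero, htsupp.trans hSpos⟩, ?_⟩
  ext x
  change (Real.exp (a * x) : ℂ) * F (Real.exp (s * x)) = g x
  have h1 : F (Real.exp (s * x)) = (Real.exp (-a * x) : ℂ) * g x := by
    simp only [F, indicator_of_mem (mem_Ioi.2 (Real.exp_pos (s * x))), Real.log_exp,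
      mul_div_cancel_left₀ _ hs]
  rw [h1, ← mul_assoc, ← Complex.ofReal_mul, ← Real.exp_add]
  simp

/-! ### The kernel of the Laplace transform in exponential variables -/

/-- The function `x ↦ e^{-x/4} exp(-e^{-x})`. -/
def laplaceKernelFun (x : ℝ) : ℂ := (Real.exp (-(1 / 4) * x) * Real.exp (-Real.exp (-x)) : ℝ)

/-- For `x ≥ 0` the factor `e^{-x/4}` provides the decay. For `x ≤ 0` and `t = e^{-x}`, both `|x|`
and `e^{-x/4}` are at most `t`, and `e^{-t}` absorbs the resulting power `t^{j+k+1}`. -/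
lemma abs_pow_mul_exp_le (k j : ℕ) : ∃ C : ℝ, ∀ x : ℝ,
    |x| ^ k * (Real.exp (-x) ^ j * (Real.exp (-(1 / 4) * x) * Real.exp (-Real.exp (-x)))) ≤ C := by
  refine ⟨k.factorial / (1 / 4) ^ k + (j + k + 1).factorial, fun x => ?_⟩
  rcases le_total 0 x with hx | hx
  · have h1 := pow_mul_exp_neg_le k (r := -(1 / 4)) (by norm_num) hx
    rw [neg_neg] at h1
    have h2 : Real.exp (-x) ^ j ≤ 1 :=
      pow_le_one₀ (Real.exp_pos _).le (Real.exp_le_one_iff.2 (by linarith))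
    have h3 : Real.exp (-Real.exp (-x)) ≤ 1 :=
      Real.exp_le_one_iff.2 (by linarith [Real.exp_pos (-x)])
    rw [abs_of_nonneg hx]
    calc x ^ k * (Real.exp (-x) ^ j * (Real.exp (-(1 / 4) * x) * Real.exp (-Real.exp (-x))))
        ≤ x ^ k * (1 * (Real.exp (-(1 / 4) * x) * 1)) := by gcongr
      _ = x ^ k * Real.exp (-(1 / 4) * x) := by ring
      _ ≤ k.factorial / (1 / 4) ^ k := h1
      _ ≤ _ := le_add_of_nonneg_right (by positivity)
  · set t := Real.exp (-x) with ht
    have ht1 : 1 ≤ t := Real.one_le_exp (by linarith)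
    have h1 : |x| ≤ t := by
      rw [abs_of_nonpos hx]
      linarith [Real.add_one_le_exp (-x)]
    have h2 : Real.exp (-(1 / 4) * x) ≤ t := Real.exp_le_exp.2 (by linarith)
    have h3 := pow_mul_exp_neg_le (j + k + 1) (r := -1) (by norm_num) (zero_le_one.trans ht1)
    rw [neg_neg, one_pow, div_one, neg_one_mul] at h3
    calc |x| ^ k * (t ^ j * (Real.exp (-(1 / 4) * x) * Real.exp (-t)))
        ≤ t ^ k * (t ^ j * (t * Real.exp (-t))) := by gcongr
      _ = t ^ (j + k + 1) * Real.exp (-t) := by ring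
      _ ≤ (j + k + 1).factorial := h3
      _ ≤ _ := le_add_of_nonneg_left (by positivity)

lemma laplaceKernelFun_hasDerivAt (x : ℝ) :
    HasDerivAt laplaceKernelFun ((Real.exp (-x) - 1 / 4) * laplaceKernelFun x) x := by
  have h1 : HasDerivAt (fun x : ℝ => Real.exp (-(1 / 4) * x) * Real.exp (-Real.exp (-x)))
      ((Real.exp (-x) - 1 / 4) * (Real.exp (-(1 / 4) * x) * Real.exp (-Real.exp (-x)))) x := by
    have h2 : HasDerivAt (fun x : ℝ => Real.exp (-(1 / 4) * x))
        (Real.exp (-(1 / 4) * x) * -(1 / 4)) x := by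
      simpa using ((hasDerivAt_id x).const_mul (-(1 / 4) : ℝ)).exp
    have h3 : HasDerivAt (fun x : ℝ => Real.exp (-Real.exp (-x)))
        (Real.exp (-Real.exp (-x)) * Real.exp (-x)) x := by
      simpa using (((hasDerivAt_id x).neg.exp).neg).exp
    exact (h2.mul h3).congr_deriv (by ring)
  exact h1.ofReal_comp.congr_deriv (by simp [laplaceKernelFun])

/-- Differentiation maps `p(e^{-x}) K(x)` to a function of the same form, so Schwartz decay reduces
to monomials in `e^{-x}` times the kernel. -/
lemma iteratedDeriv_laplaceKernelFun (n : ℕ) : ∃ p : Polynomial ℂ,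
    iteratedDeriv n laplaceKernelFun =
      fun x => p.eval (Real.exp (-x) : ℂ) * laplaceKernelFun x := by
  induction n with
  | zero => exact ⟨1, by simp⟩
  | succ n ih =>
    obtain ⟨p, hp⟩ := ih
    refine ⟨-Polynomial.X * Polynomial.derivative p +
      p * (Polynomial.X - Polynomial.C (1 / 4)), ?_⟩
    rw [iteratedDeriv_succ, hp]
    funext x
    have h1 : HasDerivAt (fun x : ℝ => (Real.exp (-x) : ℂ)) (-(Real.exp (-x) : ℂ)) x := by
      have h : HasDerivAt (fun x : ℝ => Real.exp (-x)) (-Real.exp (-x)) x := by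
        simpa using (hasDerivAt_id x).neg.exp
      exact h.ofReal_comp.congr_deriv (by simp)
    have h2 : HasDerivAt (fun x : ℝ => p.eval (Real.exp (-x) : ℂ))
        (p.derivative.eval (Real.exp (-x) : ℂ) * -(Real.exp (-x) : ℂ)) x :=
      (p.hasDerivAt _).comp x h1
    rw [(h2.fun_mul (laplaceKernelFun_hasDerivAt x)).deriv]
    simp
    ring

lemma laplaceKernelFun_decay (k n : ℕ) : ∃ C : ℝ, ∀ x : ℝ,
    ‖x‖ ^ k * ‖iteratedFDeriv ℝ n laplaceKernelFun x‖ ≤ C := by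
  obtain ⟨p, hp⟩ := iteratedDeriv_laplaceKernelFun n
  choose C hC using abs_pow_mul_exp_le k
  refine ⟨∑ i ∈ Finset.range (p.natDegree + 1), ‖p.coeff i‖ * C i, fun x => ?_⟩
  rw [norm_iteratedFDeriv_eq_norm_iteratedDeriv, hp]
  simp only [Polynomial.eval_eq_sum_range, Finset.sum_mul]
  refine (mul_le_mul_of_nonneg_left (norm_sum_le _ _) (by positivity)).trans ?_
  rw [Finset.mul_sum]
  refine Finset.sum_le_sum fun i _ => ?_
  have h : ‖laplaceKernelFun x‖ = Real.exp (-(1 / 4) * x) * Real.exp (-Real.exp (-x)) := by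
    rw [laplaceKernelFun, Complex.norm_real, Real.norm_of_nonneg (by positivity)]
  rw [norm_mul, norm_mul, norm_pow, h, Complex.norm_real, Real.norm_of_nonneg (Real.exp_pos _).le,
    Real.norm_eq_abs]
  calc _ = ‖p.coeff i‖ * (|x| ^ k * (Real.exp (-x) ^ i *
        (Real.exp (-(1 / 4) * x) * Real.exp (-Real.exp (-x))))) := by ring
    _ ≤ _ := by
      gcongr
      exact hC i x

/-- The function `x ↦ e^{-x/4} exp(-e^{-x})` as a Schwartz function. -/
def laplaceKernel : 𝓢(ℝ, ℂ) where
  toFun := laplaceKernelFun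
  smooth' := Complex.ofRealCLM.contDiff.comp <|
    (Real.contDiff_exp.comp (contDiff_const.mul contDiff_id)).mul
      (Real.contDiff_exp.comp (Real.contDiff_exp.comp contDiff_neg).neg)
  decay' := laplaceKernelFun_decay

lemma laplaceKernel_apply (x : ℝ) : laplaceKernel x =
    (Real.exp (-(1 / 4) * x) * Real.exp (-Real.exp (-x)) : ℝ) := rfl

/-- Under `t = e^{-x}` the Fourier integral becomes the Mellin transform of `e^{-t}` on the line `Re
= 1/4`, which is Euler's integral. -/
lemma fourier_laplaceKernel (ξ : ℝ) :
    (𝓕 laplaceKernel) ξ = Complex.Gamma (1 / 4 + 2 * Real.pi * ξ * Complex.I) := by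
  have hre : (1 / 4 + 2 * Real.pi * ξ * Complex.I : ℂ).re = 1 / 4 := by simp
  have him : (1 / 4 + 2 * Real.pi * ξ * Complex.I : ℂ).im = 2 * Real.pi * ξ := by simp
  rw [Complex.Gamma_eq_integral (by rw [hre]; norm_num), Complex.GammaIntegral_eq_mellin,
    mellin_eq_fourier, hre, him, mul_div_cancel_left₀ _ (by positivity), SchwartzMap.fourier_coe]
  have hfun : (laplaceKernel : ℝ → ℂ) = fun u =>
      Real.exp (-(1 / 4) * u) • (Real.exp (-Real.exp (-u)) : ℂ) := by
    funext x
    simp [laplaceKernel_apply]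
  rw [hfun]

lemma fourier_laplaceKernel_ne_zero (ξ : ℝ) : (𝓕 laplaceKernel) ξ ≠ 0 := by
  rw [fourier_laplaceKernel]
  exact Complex.Gamma_ne_zero_of_re_pos (by simp)

/-! ### The Laplace transform in exponential variables -/

/-- The linear map taking `f` to `x ↦ e^{-x/4} (L f)(e^{-x})`. -/
def laplacePullback : Test →ₗ[ℂ] 𝓢(ℝ, ℂ) :=
  (SchwartzMap.convolution (ContinuousLinearMap.mul ℂ ℂ) laplaceKernel).toLinearMap ∘ₗ
    Test.expPullback (3 / 4) one_ne_zero

lemma denseRange_laplacePullback : DenseRange laplacePullback :=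
  (SchwartzMap.denseRange_convolution_mul laplaceKernel fourier_laplaceKernel_ne_zero).comp
    (Test.denseRange_expPullback (3 / 4) one_ne_zero) (ContinuousLinearMap.continuous _)

/-- With `t = e^y` and `λ = e^{-x}`, the product `tλ` depends only on `y - x`, so the Laplace
transform becomes a convolution. The exponent `3/4` is `1`, from the Jacobian `e^y`, minus the `1/4`
carried by the kernel. -/
lemma laplacePullback_apply (f : Test) (x : ℝ) :
    laplacePullback f x = (Real.exp (-(1 / 4) * x) : ℂ) * laplace f (Real.exp (-x) : ℝ) := by
  have himg : Real.exp '' univ = Ioi 0 := by rw [image_univ, Real.range_exp]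
  have h1 : laplacePullback f x =
      ∫ y, laplaceKernel (x - y) * Test.expPullback (3 / 4) one_ne_zero f y := by
    change SchwartzMap.convolution (ContinuousLinearMap.mul ℂ ℂ) laplaceKernel _ x = _
    rw [SchwartzMap.convolution_apply, convolution_eq_swap]
    rfl
  rw [h1, laplace, ← himg, integral_image_eq_integral_abs_deriv_smul MeasurableSet.univ
    (fun x _ => (Real.hasDerivAt_exp x).hasDerivWithinAt) Real.exp_injective.injOn,
    ← integral_const_mul, setIntegral_univ]
  refine integral_congr_ae (Eventually.of_forall fun y => ?_)
  simp only [Test.expPullback_apply, laplaceKernel_apply,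
    abs_of_pos (Real.exp_pos _), one_mul, Complex.real_smul]
  have e1 : Real.exp (3 / 4 * y) * Real.exp (-(1 / 4) * (x - y)) =
      Real.exp (-(1 / 4) * x) * Real.exp y := by
    rw [← Real.exp_add, ← Real.exp_add]
    congr 1
    ring
  have e2 : Real.exp (-(x - y)) = Real.exp y * Real.exp (-x) := by
    rw [← Real.exp_add]
    congr 1
    ring
  rw [e2]
  have e3 : Complex.exp (-((Real.exp y : ℂ) * (Real.exp (-x) : ℂ))) =
      (Real.exp (-(Real.exp y * Real.exp (-x))) : ℂ) := by push_cast; rfl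
  rw [e3, Complex.ofReal_mul]
  have e1' := congrArg (fun r : ℝ => (r : ℂ)) e1
  simp only [Complex.ofReal_mul] at e1'
  linear_combination (Real.exp (-(Real.exp y * Real.exp (-x))) : ℂ) * f (Real.exp y) * e1'

/-- Since `e^{-tz} = e^{-sz} e^{-(t-s)z}`, the exponential weight distributes over the convolution,
whose integral is the product of the integrals. -/
lemma laplace_laplaceConv (f g : Test) (z : ℂ) :
    laplace (f.laplaceConv g) z = laplace f z * laplace g z := by
  rw [laplace_eq, laplace_eq, laplace_eq]
  have h := integral_convolution (ContinuousLinearMap.mul ℝ ℂ) (μ := volume) (ν := volume)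
    (laplace_integrand_integrable f z) (laplace_integrand_integrable g z)
  rw [ContinuousLinearMap.mul_apply'] at h
  rw [← h]
  refine integral_congr_ae (Eventually.of_forall fun t => ?_)
  have h2 : (f.laplaceConv g) t =
      ((f : ℝ → ℂ) ⋆[ContinuousLinearMap.mul ℝ ℂ, volume] (g : ℝ → ℂ)) t :=
    congrFun (f.laplaceConv_aux g) t
  simp only [h2, convolution, ContinuousLinearMap.mul_apply']
  rw [← integral_const_mul]
  refine integral_congr_ae (Eventually.of_forall fun s => ?_)
  have e : Complex.exp (-((t : ℂ) * z)) =
      Complex.exp (-((s : ℂ) * z)) * Complex.exp (-(((t - s : ℝ) : ℂ) * z)) := by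
    rw [← Complex.exp_add]
    congr 1
    push_cast
    ring
  simp only [e]
  ring

lemma laplace_conj (f : Test) (x : ℝ) :
    laplace f.conj x = (starRingEnd ℂ) (laplace f x) := by
  rw [laplace_eq, laplace_eq, ← integral_conj]
  refine integral_congr_ae (Eventually.of_forall fun t => ?_)
  change _ * (starRingEnd ℂ) (f t) = _
  simp only [map_mul, ← Complex.exp_conj]
  simp

end HankelSigma

end

noncomputable section

open scoped SchwartzMap

namespace HankelSigma

/-! ### Schwartz functions in logarithmic variables as elements of `𝒮₀` -/

/-- The operators `E_k` with `(d/dx)^k (x^{-1/2} g(-ln x)) = x^{-1/2-k} (E_k g)(-ln x)`. -/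
def eulerIter : ℕ → 𝓢(ℝ, ℂ) →L[ℂ] 𝓢(ℝ, ℂ)
  | 0 => ContinuousLinearMap.id ℂ _
  | k + 1 => ((-1 / 2 - k : ℂ) • ContinuousLinearMap.id ℂ _ - SchwartzMap.derivCLM ℂ ℂ) ∘L
      eulerIter k

/-- The function `x ↦ x^{-1/2} g(-ln x)` on `(0, ∞)`, extended by zero. -/
def logPullbackFun (g : 𝓢(ℝ, ℂ)) : ℝ → ℂ :=
  (Ioi (0 : ℝ)).indicator fun x => ((x ^ (-1 / 2 : ℝ) : ℝ) : ℂ) * g (-Real.log x)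

lemma logPullbackFun_eventuallyEq (g : 𝓢(ℝ, ℂ)) {x : ℝ} (hx : 0 < x) :
    logPullbackFun g =ᶠ[𝓝 x] fun x => ((x ^ (-1 / 2 : ℝ) : ℝ) : ℂ) * g (-Real.log x) := by
  filter_upwards [Ioi_mem_nhds hx] with y hy
  exact indicator_of_mem hy _

lemma iteratedDeriv_logPullbackFun (g : 𝓢(ℝ, ℂ)) (k : ℕ) {x : ℝ} (hx : 0 < x) :
    iteratedDeriv k (logPullbackFun g) x =
      ((x ^ (-1 / 2 - (k : ℝ)) : ℝ) : ℂ) * eulerIter k g (-Real.log x) := by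
  induction k generalizing x with
  | zero =>
    rw [iteratedDeriv_zero, (logPullbackFun_eventuallyEq g hx).eq_of_nhds]
    simp [eulerIter]
  | succ k ih =>
    have hev : iteratedDeriv k (logPullbackFun g) =ᶠ[𝓝 x] fun x =>
        ((x ^ (-1 / 2 - (k : ℝ)) : ℝ) : ℂ) * eulerIter k g (-Real.log x) := by
      filter_upwards [Ioi_mem_nhds hx] with y hy using ih hy
    rw [iteratedDeriv_succ, hev.deriv_eq]
    have h1 : HasDerivAt (fun x : ℝ => ((x ^ (-1 / 2 - (k : ℝ)) : ℝ) : ℂ))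
        (((-1 / 2 - (k : ℝ)) * x ^ (-1 / 2 - (k : ℝ) - 1) : ℝ) : ℂ) x :=
      (Real.hasDerivAt_rpow_const (Or.inl hx.ne')).ofReal_comp
    have h2 : HasDerivAt (fun x : ℝ => eulerIter k g (-Real.log x))
        ((-x⁻¹ : ℝ) • deriv (eulerIter k g) (-Real.log x)) x :=
      HasDerivAt.scomp x ((eulerIter k g).hasDerivAt _) (Real.hasDerivAt_log hx.ne').neg
    rw [(h1.fun_mul h2).deriv]
    have e1 : x ^ (-1 / 2 - (k : ℝ)) = x ^ (-1 / 2 - (k : ℝ) - 1) * x := by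
      rw [← Real.rpow_add_one hx.ne']
      congr 1
      ring
    have e2 : (-1 / 2 - ((k + 1 : ℕ) : ℝ)) = -1 / 2 - (k : ℝ) - 1 := by
      push_cast
      ring
    have hx' : (x : ℂ) ≠ 0 := Complex.ofReal_ne_zero.2 hx.ne'
    rw [e1, e2]
    simp only [eulerIter, ContinuousLinearMap.comp_apply, sub_apply,
      smul_apply, ContinuousLinearMap.id_apply,
      SchwartzMap.derivCLM_apply, Complex.real_smul, smul_eq_mul]
    push_cast
    field_simp
    ring

/-- A continuous seminorm which bounds `(1 + |y|)^n |g(y)|`. -/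
def weightedNorm (n : ℕ) (g : 𝓢(ℝ, ℂ)) : ℝ :=
  2 ^ n * (SchwartzMap.seminorm ℂ 0 0 g + SchwartzMap.seminorm ℂ n 0 g)

lemma weightedNorm_nonneg (n : ℕ) (g : 𝓢(ℝ, ℂ)) : 0 ≤ weightedNorm n g := by
  unfold weightedNorm
  positivity

lemma norm_le_weightedNorm (n : ℕ) (g : 𝓢(ℝ, ℂ)) (y : ℝ) :
    ‖g y‖ ≤ weightedNorm n g * (1 + |y|) ^ (-(n : ℝ)) := by
  have h0 := SchwartzMap.le_seminorm' ℂ 0 0 g y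
  have h1 := SchwartzMap.le_seminorm' ℂ n 0 g y
  rw [pow_zero, one_mul, iteratedDeriv_zero] at h0
  rw [iteratedDeriv_zero] at h1
  rw [Real.rpow_neg (by positivity), Real.rpow_natCast, ← div_eq_mul_inv,
    le_div_iff₀ (by positivity), weightedNorm]
  have h2 : (1 + |y|) ^ n ≤ 2 ^ n * (1 + |y| ^ n) := by
    have h := add_pow_le zero_le_one (abs_nonneg y) n
    rw [one_pow] at h
    refine h.trans ?_
    gcongr
    · norm_num
    · exact Nat.sub_le _ _
  calc ‖g y‖ * (1 + |y|) ^ n ≤ ‖g y‖ * (2 ^ n * (1 + |y| ^ n)) := by gcongr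
    _ = 2 ^ n * (‖g y‖ + |y| ^ n * ‖g y‖) := by ring
    _ ≤ _ := by gcongr

lemma norm_iteratedDeriv_logPullbackFun_le (g : 𝓢(ℝ, ℂ)) (k n : ℕ) {x : ℝ} (hx : 0 < x) :
    ‖iteratedDeriv k (logPullbackFun g) x‖ ≤ weightedNorm n (eulerIter k g) *
      x ^ (-1 / 2 - (k : ℝ)) * (1 + |Real.log x|) ^ (-(n : ℝ)) := by
  have hw := norm_le_weightedNorm n (eulerIter k g) (-Real.log x)
  rw [abs_neg] at hw
  rw [iteratedDeriv_logPullbackFun g k hx, norm_mul, Complex.norm_real,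
    Real.norm_of_nonneg (by positivity)]
  calc x ^ (-1 / 2 - (k : ℝ)) * ‖eulerIter k g (-Real.log x)‖
      ≤ x ^ (-1 / 2 - (k : ℝ)) *
        (weightedNorm n (eulerIter k g) * (1 + |Real.log x|) ^ (-(n : ℝ))) := by gcongr
    _ = _ := by ring

lemma logPullbackFun_mem_S0 (g : 𝓢(ℝ, ℂ)) : logPullbackFun g ∈ S0 := by
  refine ⟨fun x hx => indicator_of_notMem (not_lt.2 hx) _, fun x (hx : 0 < x) => ?_,
    fun k ϰ => ?_⟩
  · refine ContDiffAt.contDiffWithinAt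
      (ContDiffAt.congr_of_eventuallyEq ?_ (logPullbackFun_eventuallyEq g hx))
    exact (Complex.ofRealCLM.contDiff.contDiffAt.comp x
      (Real.contDiffAt_rpow_const_of_ne hx.ne')).mul
      (ContDiffAt.comp x (g.smooth ⊤).contDiffAt (Real.contDiffAt_log.2 hx.ne').neg)
  -- Since `1 + |ln x| ≥ 1`, a real exponent `ϰ` may be replaced by an integer `n ≥ ϰ`.
  · obtain ⟨n, hn⟩ := exists_nat_ge ϰ
    refine ⟨weightedNorm n (eulerIter k g), fun x hx => ?_⟩
    refine (norm_iteratedDeriv_logPullbackFun_le g k n hx).trans ?_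
    have := weightedNorm_nonneg n (eulerIter k g)
    have h1 : 1 ≤ 1 + |Real.log x| := le_add_of_nonneg_right (abs_nonneg _)
    gcongr

/-- The linear map taking a Schwartz function `g` to `x ↦ x^{-1/2} g(-ln x)`. -/
def logPullback : 𝓢(ℝ, ℂ) →ₗ[ℂ] S0 where
  toFun g := ⟨logPullbackFun g, logPullbackFun_mem_S0 g⟩
  map_add' f g := by
    refine Subtype.ext (funext fun x => ?_)
    by_cases hx : x ∈ Ioi (0 : ℝ) <;> simp [logPullbackFun, hx, mul_add]
  map_smul' c g := by
    refine Subtype.ext (funext fun x => ?_)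
    by_cases hx : x ∈ Ioi (0 : ℝ) <;> simp [logPullbackFun, hx, mul_left_comm]

/-- The bound on `τ` involves finitely many `S0` estimates. In the variable `-ln x` these are
controlled by Schwartz seminorms of `eulerIter k g`, and their sum `B` serves as the common
constant. -/
lemma S0Dual.continuous_comp_logPullback (τ : S0Dual) :
    Continuous fun g : 𝓢(ℝ, ℂ) => τ (logPullback g) := by
  obtain ⟨n, M, hM⟩ := τ.bound'
  let B : 𝓢(ℝ, ℂ) → ℝ := fun g => ∑ k ∈ Finset.range (n + 1), weightedNorm n (eulerIter k g)
  have hB : Continuous B := continuous_finsetSum _ fun k _ => continuous_const.mul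
    (((SchwartzMap.continuous_seminorm 0 0).comp (eulerIter k).continuous).add
      ((SchwartzMap.continuous_seminorm n 0).comp (eulerIter k).continuous))
  have hB0 : B 0 = 0 := by simp [B, weightedNorm]
  refine continuous_of_continuousAt_zero (τ.toFun.comp logPullback) ?_
  rw [ContinuousAt, map_zero]
  refine squeeze_zero_norm (a := fun g => M * B g) (fun g => ?_) ?_
  · refine hM _ _ fun k hk x hx => (norm_iteratedDeriv_logPullbackFun_le g k n hx).trans ?_
    have : weightedNorm n (eulerIter k g) ≤ B g :=
      Finset.single_le_sum (f := fun k => weightedNorm n (eulerIter k g))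
        (fun k _ => weightedNorm_nonneg n _) (Finset.mem_range_succ_iff.2 hk)
    gcongr
  · have := (hB.const_mul M).tendsto 0
    rwa [hB0, mul_zero] at this

/-! ### The extension of the two forms to the Schwartz space -/

/-- Complex conjugation of Schwartz functions. -/
def schwartzConj : 𝓢(ℝ, ℂ) →L[ℝ] 𝓢(ℝ, ℂ) :=
  SchwartzMap.postcompCLM (𝕜 := ℝ) (Complex.conjCLE : ℂ →L[ℝ] ℂ)

/-- The Schwartz function `|u|²`. -/
def schwartzNormSq (u : 𝓢(ℝ, ℂ)) : 𝓢(ℝ, ℂ) :=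
  SchwartzMap.pairing (ContinuousLinearMap.mul ℂ ℂ) (schwartzConj u) u

lemma schwartzNormSq_apply (u : 𝓢(ℝ, ℂ)) (x : ℝ) :
    schwartzNormSq u x = (starRingEnd ℂ) (u x) * u x := rfl

lemma continuous_schwartzNormSq : Continuous schwartzNormSq :=
  Continuous.comp (f := fun u => (schwartzConj u, u)) SchwartzMap.continuous_pairing_mul
    (schwartzConj.continuous.prodMk continuous_id)

/-- The form `⟨τ, x^{-1/2} |u(-ln x)|²⟩` on the Schwartz space. -/
def schwartzForm (τ : S0Dual) (u : 𝓢(ℝ, ℂ)) : ℂ := τ (logPullback (schwartzNormSq u))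

lemma continuous_schwartzForm (τ : S0Dual) : Continuous (schwartzForm τ) :=
  τ.continuous_comp_logPullback.comp continuous_schwartzNormSq

lemma schwartzForm_smul (τ : S0Dual) (c : ℂ) (u : 𝓢(ℝ, ℂ)) :
    schwartzForm τ (c • u) = (‖c‖ ^ 2 : ℝ) * schwartzForm τ u := by
  -- The scalar that leaves `|cu|²` is real, so the antilinearity of `τ` does not affect it.
  have h : schwartzNormSq (c • u) = ((‖c‖ ^ 2 : ℝ) : ℂ) • schwartzNormSq u := by
    ext x
    simp only [schwartzNormSq_apply, smul_apply, smul_eq_mul, map_mul]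
    push_cast
    rw [← Complex.conj_mul']
    ring
  rw [schwartzForm, h, map_smul, LinearMap.map_smulₛₗ, Complex.conj_ofReal, smul_eq_mul,
    schwartzForm]

lemma schwartzForm_re_smul (τ : S0Dual) (c : ℂ) (u : 𝓢(ℝ, ℂ)) :
    (schwartzForm τ (c • u)).re = ‖c‖ ^ 2 * (schwartzForm τ u).re := by
  rw [schwartzForm_smul, Complex.re_ofReal_mul]

/-- The weight `x^{-1/2}` cancels the two factors `e^{-y/4}` at `y = -ln x`; this is why the
exponent is `1/4`. -/
lemma logPullback_schwartzNormSq {u : 𝓢(ℝ, ℂ)} {φ : ℝ → ℂ}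
    (hu : ∀ y, u y = (Real.exp (-(1 / 4) * y) : ℂ) * φ (Real.exp (-y))) {x : ℝ} (hx : 0 < x) :
    (logPullback (schwartzNormSq u) : ℝ → ℂ) x = (starRingEnd ℂ) (φ x) * φ x := by
  change logPullbackFun _ x = _
  rw [(logPullbackFun_eventuallyEq _ hx).eq_of_nhds, schwartzNormSq_apply, hu, neg_neg,
    Real.exp_log hx, map_mul, Complex.conj_ofReal]
  have h : x ^ (-1 / 2 : ℝ) * (Real.exp (-(1 / 4) * -Real.log x) *
      Real.exp (-(1 / 4) * -Real.log x)) = 1 := by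
    rw [Real.rpow_def_of_pos hx, ← Real.exp_add, ← Real.exp_add, Real.exp_eq_one_iff]
    ring
  have h' := congrArg (fun r : ℝ => (r : ℂ)) h
  simp only [Complex.ofReal_mul, Complex.ofReal_one] at h'
  linear_combination (starRingEnd ℂ) (φ x) * φ x * h'

/-- The linear map taking `w` to `x ↦ e^{-x/4} w(e^{-x})`. -/
def sigmaPullback : Test →ₗ[ℂ] 𝓢(ℝ, ℂ) :=
  Test.expPullback (-(1 / 4)) (neg_ne_zero.2 one_ne_zero)

lemma denseRange_sigmaPullback : DenseRange sigmaPullback := Test.denseRange_expPullback _ _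

lemma sigmaForm_eq (τ : S0Dual) (w : Test) : sigmaForm τ w = schwartzForm τ (sigmaPullback w) := by
  rw [sigmaForm, schwartzForm]
  congr 1
  refine Subtype.ext (funext fun x => ?_)
  rcases le_or_gt x 0 with hx | hx
  · rw [(logPullback _).2.1 x hx, (w.conj.mul w).toS0.2.1 x hx]
  · rw [logPullback_schwartzNormSq (φ := w) (fun y => ?_) hx]
    · rfl
    · rw [sigmaPullback, Test.expPullback_apply, neg_one_mul]

/-- The hypothesis on `τ` involves only restrictions to the half-line, and there `L(f̄ ⋆ f) = |L
f|²`, since conjugation commutes with `L` at real points. -/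
lemma hankelForm_eq {h : TestDual} {σ : YDual} (hσ : IsSigmaFunction h σ) {τ : S0Dual}
    (hτ : IsGivenBy σ τ) (f : Test) : hankelForm h f = schwartzForm τ (laplacePullback f) := by
  rw [hankelForm, hσ, hτ, schwartzForm]
  congr 1
  refine Subtype.ext (funext fun x => ?_)
  rcases le_or_gt x 0 with hx | hx
  · rw [(logPullback _).2.1 x hx, (Y.restrict _).2.1 x hx]
  · rw [logPullback_schwartzNormSq (φ := fun x => laplace f x)
      (fun y => laplacePullback_apply f y) hx]
    change (Ioi (0 : ℝ)).indicator (fun x : ℝ => laplace (f.conj.laplaceConv f) x) x = _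
    rw [indicator_of_mem (mem_Ioi.2 hx), laplace_laplaceConv, laplace_conj]

/-! ### Forms bounded below on an interval -/

/-- The test functions supported in `(a, b)`. -/
def Test.supportedIn (a b : ℝ) : Submodule ℂ Test where
  carrier := {φ | tsupport φ ⊆ Ioo a b}
  zero_mem' := by
    change tsupport (0 : ℝ → ℂ) ⊆ _
    simp
  add_mem' := fun {φ ψ} hφ hψ => (tsupport_add φ ψ).trans (union_subset hφ hψ)
  smul_mem' := fun c φ hφ => (tsupport_smul_subset_right (fun _ => c) φ).trans hφ

/-- Polynomials times a fixed bump `β` form an infinite-dimensional space: `β = 1` on an interval,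
and a polynomial vanishing there is zero. -/
lemma Test.aleph0_le_rank_supportedIn {a b : ℝ} (ha : 0 ≤ a) (hab : a < b) :
    Cardinal.aleph0 ≤ Module.rank ℂ (Test.supportedIn a b) := by
  let β : ContDiffBump ((a + b) / 2) := ⟨(b - a) / 8, (b - a) / 4, by linarith, by linarith⟩
  have hβ : tsupport (fun x => (β x : ℂ)) ⊆ Ioo a b := by
    refine (closure_mono (Function.support_comp_subset Complex.ofReal_zero β)).trans ?_
    refine (β.tsupport_eq.subset.trans ?_)
    rw [Real.closedBall_eq_Icc]
    intro x hx
    have h1 := hx.1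
    have h2 := hx.2
    simp only [β] at h1 h2
    constructor <;> linarith
  have hpos : Ioo a b ⊆ (Rpos : Set ℝ) := fun x hx => lt_of_le_of_lt ha hx.1
  have hsm : ContDiff ℝ ∞ fun x => (β x : ℂ) := Complex.ofRealCLM.contDiff.comp β.contDiff
  have hcs : HasCompactSupport fun x => (β x : ℂ) :=
    β.hasCompactSupport.comp_left (g := fun r : ℝ => (r : ℂ)) Complex.ofReal_zero
  have hts : ∀ p : Polynomial ℂ, tsupport (fun x : ℝ => p.eval (x : ℂ) * (β x : ℂ)) ⊆ Ioo a b :=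
    fun p => tsupport_mul_subset_right.trans hβ
  let T : Polynomial ℂ →ₗ[ℂ] Test.supportedIn a b :=
    { toFun := fun p => ⟨⟨fun x => p.eval (x : ℂ) * (β x : ℂ),
        ((p.differentiable.contDiff.restrict_scalars ℝ).comp Complex.ofRealCLM.contDiff).mul hsm,
        hcs.mul_left, (hts p).trans hpos⟩, hts p⟩
      map_add' := fun p q => by
        refine Subtype.ext (TestFunction.ext fun x => ?_)
        change (p + q).eval (x : ℂ) * (β x : ℂ) =
          p.eval (x : ℂ) * (β x : ℂ) + q.eval (x : ℂ) * (β x : ℂ)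
        rw [Polynomial.eval_add, add_mul]
      map_smul' := fun c p => by
        refine Subtype.ext (TestFunction.ext fun x => ?_)
        change (c • p).eval (x : ℂ) * (β x : ℂ) = c * (p.eval (x : ℂ) * (β x : ℂ))
        rw [Polynomial.eval_smul, smul_eq_mul, mul_assoc] }
  have hT : Function.Injective T := by
    refine (injective_iff_map_eq_zero T).2 fun p hp => p.eq_zero_of_infinite_isRoot ?_
    refine ((Icc_infinite (by linarith : (a + b) / 2 < (a + b) / 2 + (b - a) / 8)).image
      Complex.ofReal_injective.injOn).mono ?_
    rintro _ ⟨x, hx, rfl⟩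
    have h1 : p.eval (x : ℂ) * (β x : ℂ) = 0 :=
      congrArg (fun φ : Test.supportedIn a b => φ.1 x) hp
    have h2 : β x = 1 := by
      refine β.one_of_mem_closedBall ?_
      rw [Real.closedBall_eq_Icc]
      simp only [β]
      exact ⟨by linarith [hx.1], hx.2⟩
    simpa [h2] using h1
  calc Cardinal.aleph0 = Module.rank ℂ (Polynomial ℂ) := by
        rw [← (Polynomial.basisMonomials ℂ).mk_eq_rank'', Cardinal.mk_nat]
    _ ≤ _ := LinearMap.rank_le_of_injective T hT

lemma integral_mul_norm_sq_pos {s : ℝ → ℝ} {a b c : ℝ} (hc : 0 < c)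
    (hs : LocallyIntegrableOn s (Ioo a b)) (hle : ∀ᵐ x ∂(volume.restrict (Ioo a b)), c ≤ s x)
    {φ : Test} (hφ : tsupport φ ⊆ Ioo a b) (hφ0 : φ ≠ 0) : 0 < ∫ x, s x * ‖φ x‖ ^ 2 := by
  have hcs : HasCompactSupport fun x => ‖φ x‖ ^ 2 :=
    φ.hasCompactSupport.comp_left (g := fun z : ℂ => ‖z‖ ^ 2) (by simp)
  have hcont : Continuous fun x => ‖φ x‖ ^ 2 := φ.continuous.norm.pow 2
  have hsub : tsupport (fun x => ‖φ x‖ ^ 2) ⊆ tsupport φ :=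
    closure_mono (Function.support_comp_subset (g := fun z : ℂ => ‖z‖ ^ 2) (by simp) φ)
  -- The function `s` is only locally integrable on the open interval, which suffices because `φ`
  -- has compact support inside it.
  have hint : Integrable fun x => s x * ‖φ x‖ ^ 2 := by
    have h1 : IntegrableOn (fun x => s x * ‖φ x‖ ^ 2) (tsupport φ) :=
      (hs.integrableOn_compact_subset hφ φ.hasCompactSupport.isCompact).mul_continuousOn
        hcont.continuousOn φ.hasCompactSupport.isCompact
    refine (integrableOn_iff_integrable_of_support_subset fun x hx => ?_).1 h1
    exact hsub (subset_tsupport _ (right_ne_zero_of_mul hx))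
  have hint' : Integrable fun x => c * ‖φ x‖ ^ 2 :=
    (hcont.integrable_of_hasCompactSupport hcs).const_mul c
  obtain ⟨x₀, hx₀⟩ : ∃ x, φ x ≠ 0 := by
    by_contra! h
    exact hφ0 (TestFunction.ext h)
  have hpos : 0 < ∫ x, ‖φ x‖ ^ 2 :=
    hcont.integral_pos_of_hasCompactSupport_nonneg_nonzero hcs (fun x => by positivity)
      (x := x₀) (by simpa using hx₀)
  calc 0 < c * ∫ x, ‖φ x‖ ^ 2 := mul_pos hc hpos
    _ = ∫ x, c * ‖φ x‖ ^ 2 := (integral_const_mul _ _).symm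
    _ ≤ _ := by
      refine integral_mono_ae hint' hint ?_
      filter_upwards [(ae_restrict_iff' measurableSet_Ioo).1 hle] with x hx
      by_cases h : x ∈ tsupport φ
      · exact mul_le_mul_of_nonneg_right (hx (hφ h)) (by positivity)
      · simp [image_eq_zero_of_notMem_tsupport h]

lemma S0Dual.EqFunOn.sigmaForm_re {τ : S0Dual} {s : ℝ → ℝ} {a b : ℝ} (h : τ.EqFunOn s a b)
    {φ : Test} (hφ : tsupport φ ⊆ Ioo a b) :
    (sigmaForm τ φ).re = ∫ x, s x * ‖φ x‖ ^ 2 := by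
  have h1 : sigmaForm τ φ = ∫ x, ((s x * ‖φ x‖ ^ 2 : ℝ) : ℂ) := by
    rw [sigmaForm, h.2 _ (tsupport_mul_subset_right.trans hφ)]
    refine integral_congr_ae (Eventually.of_forall fun x => ?_)
    change (s x : ℂ) * (starRingEnd ℂ) ((starRingEnd ℂ) (φ x) * φ x) = _
    rw [Complex.conj_mul', map_pow, Complex.conj_ofReal]
    push_cast
    rfl
  rw [h1, integral_complex_ofReal, Complex.ofReal_re]

end HankelSigma

end

/-! ### The main theorem -/

open HankelSigma
theorem theorem4p8
    (h : TestDual) (σ : YDual) (hσ : IsSigmaFunction h σ)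
    (τ : S0Dual) (hτ : IsGivenBy σ τ) :
    (Npos (fun f : Test => (hankelForm h f).re) = Npos (fun w : Test => (sigmaForm τ w).re) ∧
      Nneg (fun f : Test => (hankelForm h f).re) = Nneg (fun w : Test => (sigmaForm τ w).re)) ∧
    ((τ.Nonneg → ∀ f : Test, 0 ≤ hankelForm h f) ∧
      (τ.Nonpos → ∀ f : Test, hankelForm h f ≤ 0)) ∧
    (∀ (a b c : ℝ) (s : ℝ → ℝ), 0 ≤ a → a < b → 0 < c → τ.EqFunOn s a b →
      ((∀ᵐ x ∂(volume.restrict (Ioo a b)), c ≤ s x) →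
        Npos (fun f : Test => (hankelForm h f).re) = ⊤) ∧
      ((∀ᵐ x ∂(volume.restrict (Ioo a b)), c ≤ -s x) →
        Nneg (fun f : Test => (hankelForm h f).re) = ⊤)) := by
  have hre : Continuous fun u => (schwartzForm τ u).re :=
    Complex.continuous_re.comp (continuous_schwartzForm τ)
  have hN : Npos (fun f : Test => (hankelForm h f).re) =
      Npos (fun w : Test => (sigmaForm τ w).re) := by
    simp only [hankelForm_eq hσ hτ, sigmaForm_eq]
    exact Npos_comp_eq_of_denseRange hre (schwartzForm_re_smul τ) _ _
      denseRange_laplacePullback denseRange_sigmaPullback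
  have hN' : Nneg (fun f : Test => (hankelForm h f).re) =
      Nneg (fun w : Test => (sigmaForm τ w).re) := by
    simp only [Nneg, hankelForm_eq hσ hτ, sigmaForm_eq]
    exact Npos_comp_eq_of_denseRange (q := fun u => -(schwartzForm τ u).re) hre.neg
      (fun c u => by rw [schwartzForm_re_smul, mul_neg]) _ _
      denseRange_laplacePullback denseRange_sigmaPullback
  have hsq : ∀ (w : Test) (x : ℝ), 0 ≤ (w.conj.mul w) x := fun w x => star_mul_self_nonneg (w x)
  refine ⟨⟨hN, hN'⟩, ⟨fun hpos f => ?_, fun hneg f => ?_⟩, fun a b c s ha hab hc hs =>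
    ⟨fun hle => ?_, fun hle => ?_⟩⟩
  · rw [hankelForm_eq hσ hτ]
    -- In the order of `ℂ` the set `{z | 0 ≤ z}` is the closed nonnegative real half-line, so it is
    -- enough to check the sign on the dense family `sigmaPullback w`, where `|w|²` is a nonnegative
    -- test function.
    refine denseRange_sigmaPullback.induction_on (laplacePullback f)
      (isClosed_Ici.preimage (continuous_schwartzForm τ)) fun w => ?_
    rw [← sigmaForm_eq]
    exact hpos _ (hsq w)
  · rw [hankelForm_eq hσ hτ]
    refine denseRange_sigmaPullback.induction_on (laplacePullback f)
      (isClosed_Iic.preimage (continuous_schwartzForm τ)) fun w => ?_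
    rw [← sigmaForm_eq]
    exact hneg _ (hsq w)
  · rw [hN]
    refine Npos_eq_top (Test.supportedIn a b) (fun φ hφ hφ0 => ?_)
      (Test.aleph0_le_rank_supportedIn ha hab)
    rw [hs.sigmaForm_re hφ]
    exact integral_mul_norm_sq_pos hc hs.1 hle hφ hφ0
  · rw [hN']
    refine Npos_eq_top (Test.supportedIn a b) (fun φ hφ hφ0 => ?_)
      (Test.aleph0_le_rank_supportedIn ha hab)
    change 0 < -(sigmaForm τ φ).re
    rw [hs.sigmaForm_re hφ, ← integral_neg]
    simp only [← neg_mul]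
    exact integral_mul_norm_sq_pos hc hs.1.neg hle hφ hφ0
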